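/- Let $k\ge 1$ and let $\Lambda$ be a finite strongly connected $k$-graph with vertex set $\Lambda^0$ and vertex matrices $A_i(v,w)=|v\Lambda^{e_i}w|$, whose spectral radii satisfy $\rho_i=\rho(A_i)>1$ for $1\le i\le k$. Let $\kappa\in(0,\infty)^{\Lambda^0}$ be the unimodular Perron–Frobenius eigenvector ($\sum_v\kappa_v=1$, $A_i\kappa=\rho_i\kappa$ for all $i$). Let $\mathcal B$ be the associated stationary $k$-Bratteli diagram: all levels $V_0,V_1,\dots$ are copies of $\Lambda^0$, and for $n\ge 0$ there are $A_i(p,q)$ edges with range $p\in V_n$ and source $q\in V_{n+1}$, where $i\equiv n+1 \pmod k$. Let $F\mathcal B$ be the set of finite paths with range in $V_0$ (vertices of $V_0$ included), $\partial\mathcal B$ the space of infinite paths starting in $V_0$ with the topology generated by the cylinder sets $[\gamma]$, $\gamma\in F\mathcal B$. For $|\gamma|=n=qk+t$, $0\le t<k$, put $P_n=\rho_1^{q+1}\cdots\rho_t^{q+1}\rho_{t+1}^q\cdots\rho_k^q$. Let $\mu$ be the Borel probability measure on $\partial\mathcal B$ with $\mu[\gamma]=P_{|\gamma|}^{-1}\kappa_{s(\gamma)}$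 for all $\gamma\in F\mathcal B$. For $\delta\in(0,1)$ let $w(\gamma)=w_\delta(\gamma)=P_{|\gamma|}^{-1/\delta}\kappa_{s(\gamma)}$. For $x\neq y$ let $x\wedge y$ be the longest common initial sub-path, with $x\wedge y=\emptyset$ if $r(x)\ne r(y)$; let $d_w(x,x)=0$, and for $x\ne y$ let $d_w(x,y)=1$ if $x\wedge y=\emptyset$ and $d_w(x,y)=w(x\wedge y)$ otherwise. Assume that $\operatorname{diam}_{d_w}[\gamma]=w(\gamma)$ for all $\gamma\in F\mathcal B$. A choice function is a map $\phi=(\phi_1,\phi_2)$ assigning to each $\gamma\in F\mathcal B$ a pair $\phi(\gamma)\in[\gamma]\times[\gamma]$ with $d_w(\phi_1(\gamma),\phi_2(\gamma))=\operatorname{diam}[\gamma]$. Let $\operatorname{ext}_1(\gamma)$ be the set of ordered pairs of distinct edges extending $\gamma$ by one generation, and let $\nu=\prod_\gamma\nu_\gamma$ be the product measure on the space $\Xi$ of choice functions, where $\nu_\gamma=(\mu\times\mu)/\sum_{(e,e')\in\operatorname{ext}_1(\gamma)}\mu[\gamma e]\mu[\gamma e']$, restricted to the pairs admissible at $\gamma$.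 Let $\mathbb K$ be $\mathbb R$ or $\mathbb C$. On $\ell^2(F\mathcal B)\otimes\mathbb K^2$ let $D=\bigoplus_\gamma \frac1{w(\gamma)}\begin{pmatrix}0&1\\1&0\end{pmatrix}$ and $\pi_\phi(f)=\bigoplus_\gamma\begin{pmatrix}f(\phi_1(\gamma))&0\\0&f(\phi_2(\gamma))\end{pmatrix}$ (possibly unbounded operators, with maximal domains), and for $s\in\mathbb R$ let $$Q_s(f,g)=\frac12\int_\Xi \operatorname{Tr}\big(|D|^{-s}[D,\pi_\phi(f)]^*[D,\pi_\phi(g)]\big)\,d\nu(\phi),$$ where the trace is the sum of the diagonal matrix coefficients in the standard orthonormal basis. Let $$J_s(\gamma)=\frac{w_\delta(\gamma)^{s-2}}{\sum_{(e,e')\in\operatorname{ext}_1(\gamma)}\mu[\gamma e]\,\mu[\gamma e']}\qquad(\gamma\in F\mathcal B),\qquad J_s(\emptyset)=0,$$ $$\mathcal Q_{J_s,\mu}(f,g)=\iint J_s(x\wedge y)\,\overline{(f(x)-f(y))}\,(g(x)-g(y))\,d\mu(x)\,d\mu(y),$$ and let $\mathcal D_{J_s,\mu}$ be the set of $f\in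 L^2(\partial\mathcal B,\mu;\mathbb K)$ with $\iint J_s(x\wedge y)|f(x)-f(y)|^2\,d\mu\,d\mu<\infty$ (the integrands are $0$ on the diagonal $x=y$). Then, for every $s\in\mathbb R$: 1. A function $f\in L^2(\partial\mathcal B,\mu;\mathbb K)$ lies in $\mathcal D_{J_s,\mu}$ if and only if the defining integral of $Q_s(f,f)$ exists, that is, for $\nu$-almost every $\phi$ all vectors of the standard basis lie in the domain of $|D|^{-s}[D,\pi_\phi(f)]^*[D,\pi_\phi(f)]$ and the series of its diagonal coefficients converges absolutely, and the resulting trace is $\nu$-integrable in $\phi$. 2. For all $f,g\in\mathcal D_{J_s,\mu}$ the defining integral of $Q_s(f,g)$ exists in the same sense, the integral defining $\mathcal Q_{J_s,\mu}(f,g)$ converges absolutely, and $Q_s(f,g)=\mathcal Q_{J_s,\mu}(f,g)$. 3. The form $Q_s$ on the linear span of the characteristic functions $\chi_{[\gamma]}$, $\gamma\in F\mathcal B$, is closable in $L^2(\partial\mathcal B,\mu;\mathbb K)$, and its closure is the form $\mathcal Q_{J_s,\mu}$ with domain $\mathcal D_{J_s,\mu}$. Thus the Dirichlet form $(Q_s,\operatorname{Dom}(Q_s))$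 coincides with $(\mathcal Q_{J_s,\mu},\mathcal D_{J_s,\mu})$. -/

import Mathlib

open MeasureTheory Filter Topology CategoryTheory
open scoped ENNReal

universe u v

/-! ### Higher-rank graphs -/

/-- A `k`-graph structure on a small category `Λ`: a degree functor to `ℕ^k` with the factorization
property.  A path `lam` with source `w` and range `v` is a morphism `lam : w ⟶ v`, so that the
product of paths `p q` (with `s(p) = r(q)`) is the composite `q ≫ p`. -/
structure HigherRankGraph (k : ℕ) (Λ : Type u) [Category.{v} Λ] where
  d : ∀ {w v : Λ}, (w ⟶ v) → (Fin k → ℕ)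
  d_id : ∀ v : Λ, d (𝟙 v) = 0
  d_comp : ∀ {w x v : Λ} (q : w ⟶ x) (p : x ⟶ v), d (q ≫ p) = d p + d q
  factorization : ∀ {w v : Λ} (lam : w ⟶ v) (m n : Fin k → ℕ), d lam = m + n →
    ∃! t : (Σ x : Λ, (x ⟶ v) × (w ⟶ x)), d t.2.1 = m ∧ d t.2.2 = n ∧ t.2.2 ≫ t.2.1 = lam

namespace HigherRankGraph

variable {k : ℕ} {Λ : Type u} [Category.{v} Λ]

/-- `|Λ^n| < ∞` for every `n ∈ ℕ^k`. -/
def IsFinite (G : HigherRankGraph k Λ) : Prop :=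
  ∀ n : Fin k → ℕ, Finite (Σ (v : Λ) (w : Λ), {lam : w ⟶ v // G.d lam = n})

/-- `v Λ w ≠ ∅` for all vertices `v`, `w`. -/
def IsStronglyConnected (_G : HigherRankGraph k Λ) : Prop :=
  ∀ v w : Λ, Nonempty (w ⟶ v)

/-- The vertex matrices `A_i(v, w) = |v Λ^{e_i} w|`. -/
noncomputable def vertexMatrix (G : HigherRankGraph k Λ) (i : Fin k) : Matrix Λ Λ ℕ :=
  fun v w => Nat.card {lam : w ⟶ v // G.d lam = Pi.single i 1}

end HigherRankGraph

/-! ### The stationary `k`-Bratteli diagram of a family of matrices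

All levels `V_0, V_1, …` are copies of `V`.  The edges between level `n` (range) and level `n + 1`
(source) are counted by the matrix with index `n mod k`, in the zero-based numbering of `Fin k`:
`A_1` is used between levels `0` and `1`, …, `A_k` between levels `k - 1` and `k`, and then again
`A_1`, and so on. -/

section Bratteli

variable {k : ℕ} [NeZero k] {V : Type u} (A : Fin k → Matrix V V ℕ)

/-- `BPath A n q`: the paths of length `n` with range in level `0` and with source the copy of
`q` in level `n`. -/
inductive BPath : ℕ → V → Type u
  | vertex (p : V) : BPath 0 p
  | snoc {n : ℕ} {p : V} (γ : BPath n p) (q : V) (e : Fin (A (Fin.ofNat k n) p q)) : BPath (n + 1) q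

/-- The set `Fℬ` of all finite paths with range in level `0`. -/
abbrev FinPath : Type u := Σ (n : ℕ) (q : V), BPath A n q

/-- The infinite path space `∂ℬ`. -/
structure InfPath where
  vert : ℕ → V
  edge : ∀ n, Fin (A (Fin.ofNat k n) (vert n) (vert (n + 1)))

variable {A}

/-- The length `|γ|`. -/
def FinPath.len (γ : FinPath A) : ℕ := γ.1

/-- The source `s(γ)`. -/
def FinPath.src (γ : FinPath A) : V := γ.2.1

/-- The edges `e` with `r(e) = s(γ)`, i.e. the edges that extend `γ` by one generation. -/
abbrev FinPath.Ext (γ : FinPath A) : Type u := Σ q : V, Fin (A (Fin.ofNat k γ.len) γ.src q)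

/-- The extended path `γ e`. -/
def FinPath.extend (γ : FinPath A) (e : γ.Ext) : FinPath A :=
  ⟨γ.1 + 1, e.1, BPath.snoc γ.2.2 e.1 e.2⟩

def InfPath.takeAux (x : InfPath A) : ∀ n, BPath A n (x.vert n)
  | 0 => BPath.vertex (x.vert 0)
  | n + 1 => BPath.snoc (x.takeAux n) (x.vert (n + 1)) (x.edge n)

/-- The initial sub-path of length `n` of an infinite path. -/
def InfPath.take (x : InfPath A) (n : ℕ) : FinPath A := ⟨n, x.vert n, x.takeAux n⟩

/-- The cylinder set `[γ]`. -/
def cylinder (γ : FinPath A) : Set (InfPath A) := {x | x.take γ.len = γ}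

instance : TopologicalSpace (InfPath A) :=
  TopologicalSpace.generateFrom (Set.range (cylinder (A := A)))

instance : MeasurableSpace (InfPath A) := borel _

instance : BorelSpace (InfPath A) := ⟨rfl⟩

theorem measurableSet_cylinder (γ : FinPath A) : MeasurableSet (cylinder γ) :=
  IsOpen.measurableSet (TopologicalSpace.isOpen_generateFrom_of_mem (Set.mem_range_self γ))

open Classical in
/-- The longest common initial sub-path `x ∧ y` of `x ≠ y`; it is `none` (the empty path) when
`r(x) ≠ r(y)`. -/
noncomputable def meet (x y : InfPath A) : Option (FinPath A) :=
  if x.take 0 = y.take 0 then some (x.take (sSup {n | x.take n = y.take n})) else none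

open Classical in
/-- The ultrametric `d_w` of a weight `w`. -/
noncomputable def weightDist (w : FinPath A → ℝ) (x y : InfPath A) : ℝ :=
  if x = y then 0 else (meet x y).elim 1 w

/-- The diameter of `[γ]` with respect to `d_w`. -/
noncomputable def cylinderDiam (w : FinPath A → ℝ) (γ : FinPath A) : ℝ :=
  sSup {r | ∃ x ∈ cylinder γ, ∃ y ∈ cylinder γ, r = weightDist w x y}

variable (A) [Fintype V] [DecidableEq V]

/-- The spectral radius `ρ_i` of `A_i`. -/
noncomputable def rho (i : Fin k) : ℝ := (spectralRadius ℂ ((A i).map (fun m : ℕ => (m : ℂ)))).toReal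

/-- For `n = q k + t` with `0 ≤ t < k`, the number `ρ_1^{q+1} ⋯ ρ_t^{q+1} ρ_{t+1}^q ⋯ ρ_k^q`. -/
noncomputable def levelProd (n : ℕ) : ℝ :=
  ∏ i : Fin k, rho A i ^ (n / k + if (i : ℕ) < n % k then 1 else 0)

/-- `κ` is the unimodular Perron-Frobenius eigenvector: the positive vector with sum `1` and
`A_i κ = ρ_i κ` for all `i`. -/
structure IsPerronFrobeniusVector (κ : V → ℝ) : Prop where
  pos : ∀ v, 0 < κ v
  sum_eq_one : ∑ v, κ v = 1
  eigen : ∀ i, ((A i).map (fun m : ℕ => (m : ℝ))).mulVec κ = rho A i • κ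

/-- The weight `w_δ`. -/
noncomputable def wt (κ : V → ℝ) (δ : ℝ) (γ : FinPath A) : ℝ :=
  levelProd A γ.len ^ (-1 / δ) * κ γ.src

/-- `μ` is the Perron-Frobenius measure on `∂ℬ`: the Borel measure with
`μ[γ] = (ρ_1^{q+1} ⋯ ρ_t^{q+1} ρ_{t+1}^q ⋯ ρ_k^q)⁻¹ κ_{s(γ)}` for `|γ| = q k + t`. -/
def IsPerronFrobeniusMeasure (κ : V → ℝ) (μ : Measure (InfPath A)) : Prop :=
  ∀ γ : FinPath A, μ (cylinder γ) = ENNReal.ofReal ((levelProd A γ.len)⁻¹ * κ γ.src)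

variable {A}

/-- The sum of `μ[γ e] μ[γ e']` over the set `ext_1(γ)` of ordered pairs `(e, e')` of distinct edges
that extend `γ`. -/
noncomputable def extSum (μ : Measure (InfPath A)) (γ : FinPath A) : ℝ :=
  ∑ p ∈ (Finset.univ : Finset γ.Ext).offDiag,
    μ.real (cylinder (γ.extend p.1)) * μ.real (cylinder (γ.extend p.2))

/-- The generalized jump kernel `J_s`. -/
noncomputable def jumpKernel (κ : V → ℝ) (δ s : ℝ) (μ : Measure (InfPath A)) (γ : FinPath A) : ℝ :=
  wt A κ δ γ ^ (s - 2) / extSum μ γ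

end Bratteli

/-! ### Jump type forms -/

section JumpForm

variable {k : ℕ} [NeZero k] {V : Type u} {A : Fin k → Matrix V V ℕ} {𝕜 : Type*} [RCLike 𝕜]

open Classical in
/-- `W_J(x, y) = J(x ∧ y)`, with value `0` if `x = y` or if `x ∧ y` is the empty path. -/
noncomputable def jumpWeight (J : FinPath A → ℝ) (x y : InfPath A) : ℝ :=
  if x = y then 0 else (meet x y).elim 0 J

/-- The integrand `W_J(x,y) conj(f(x) - f(y)) (g(x) - g(y))`; for `𝕜 = ℝ` the conjugation is
trivial. -/
noncomputable def jumpIntegrand (J : FinPath A → ℝ) (f g : InfPath A → 𝕜)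
    (p : InfPath A × InfPath A) : 𝕜 :=
  (jumpWeight J p.1 p.2 : 𝕜) * (starRingEnd 𝕜 (f p.1 - f p.2) * (g p.1 - g p.2))

/-- The form `𝒬_{J,μ}(f, g)`. -/
noncomputable def jumpForm (J : FinPath A → ℝ) (μ : Measure (InfPath A)) (f g : InfPath A → 𝕜) : 𝕜 :=
  ∫ p, jumpIntegrand J f g p ∂(μ.prod μ)

/-- `f` is square integrable with `∫∫ W_J(x,y) |f(x) - f(y)|² dμ dμ < ∞`. -/
def HasFiniteJumpEnergy (J : FinPath A → ℝ) (μ : Measure (InfPath A)) (f : InfPath A → 𝕜) : Prop :=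
  MemLp f 2 μ ∧
    ∫⁻ p, ENNReal.ofReal (jumpWeight J p.1 p.2 * ‖f p.1 - f p.2‖ ^ 2) ∂(μ.prod μ) < ∞

/-- The domain `𝒟_{J,μ} ⊆ L²`. -/
def jumpDomain (𝕜 : Type*) [RCLike 𝕜] (J : FinPath A → ℝ) (μ : Measure (InfPath A)) :
    Set (Lp 𝕜 2 μ) :=
  {f | HasFiniteJumpEnergy J μ f}

/-- The linear span of the characteristic functions of cylinder sets in `L²`. -/
noncomputable def cylinderSpan (𝕜 : Type*) [RCLike 𝕜] (μ : Measure (InfPath A))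
    [IsFiniteMeasure μ] : Submodule 𝕜 (Lp 𝕜 2 μ) :=
  Submodule.span 𝕜 (Set.range fun γ : FinPath A =>
    indicatorConstLp 2 (measurableSet_cylinder γ) (measure_ne_top μ _) (1 : 𝕜))

end JumpForm

/-! ### Closure of a form -/

section Closure

variable {𝕜 E : Type*} [RCLike 𝕜] [NormedAddCommGroup E] [InnerProductSpace 𝕜 E]

/-- `u` is a sequence in `C` that converges to `f` in norm and is Cauchy for the form `q`. -/
structure FormApprox (q : E → E → 𝕜) (C : Submodule 𝕜 E) (u : ℕ → E) (f : E) : Prop where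
  mem : ∀ n, u n ∈ C
  tendsto : Tendsto u atTop (𝓝 f)
  cauchy : Tendsto (fun p : ℕ × ℕ => q (u p.1 - u p.2) (u p.1 - u p.2)) atTop (𝓝 0)

/-- The form `q` with domain `C` is closable, and its closure is the form `Q` with domain `Dom`. -/
structure IsFormClosure (q : E → E → 𝕜) (C : Submodule 𝕜 E) (Q : E → E → 𝕜) (Dom : Set E) :
    Prop where
  closable : ∀ u : ℕ → E, FormApprox q C u 0 → Tendsto (fun n => q (u n) (u n)) atTop (𝓝 0)
  mem_iff : ∀ f : E, f ∈ Dom ↔ ∃ u : ℕ → E, FormApprox q C u f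
  form_eq : ∀ (f g : E) (u v : ℕ → E), FormApprox q C u f → FormApprox q C v g →
    Tendsto (fun n => q (u n) (v n)) atTop (𝓝 (Q f g))

end Closure

/-! ### Operators on `ℓ²(ι) ⊗ 𝕜²` -/

section Operators

variable {ι 𝕜 : Type*} [RCLike 𝕜]

/-- `ℓ²(ι) ⊗ 𝕜²`, as the space of square summable families of vectors in `𝕜²`. -/
abbrev SpinorSpace (ι 𝕜 : Type*) [RCLike 𝕜] : Type _ :=
  lp (fun _ : ι => EuclideanSpace 𝕜 (Fin 2)) 2

/-- The direct sum `⨁ M_i` as an operator in `ℓ²(ι) ⊗ 𝕜²` with its maximal domain. -/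
noncomputable def directSumOp (M : ι → Matrix (Fin 2) (Fin 2) 𝕜) :
    SpinorSpace ι 𝕜 →ₗ.[𝕜] SpinorSpace ι 𝕜 where
  domain :=
    { carrier := {ξ | Memℓp (fun i => Matrix.toEuclideanLin (M i) (ξ i)) 2}
      zero_mem' := by
        have h : (fun i => Matrix.toEuclideanLin (M i) ((0 : SpinorSpace ι 𝕜) i)) = 0 := by
          funext i; simp
        simp only [Set.mem_ofPred_eq, h]
        exact zero_memℓp
      add_mem' := by
        intro a b ha hb
        have h : (fun i => Matrix.toEuclideanLin (M i) ((a + b : SpinorSpace ι 𝕜) i))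
            = (fun i => Matrix.toEuclideanLin (M i) (a i))
              + fun i => Matrix.toEuclideanLin (M i) (b i) := by
          funext i; simp
        simp only [Set.mem_ofPred_eq, h]
        exact Memℓp.add ha hb
      smul_mem' := by
        intro c a ha
        have h : (fun i => Matrix.toEuclideanLin (M i) ((c • a : SpinorSpace ι 𝕜) i))
            = c • fun i => Matrix.toEuclideanLin (M i) (a i) := by
          funext i; simp
        simp only [Set.mem_ofPred_eq, h]
        exact Memℓp.const_smul ha c }
  toFun :=
    { toFun := fun ξ => ⟨fun i => Matrix.toEuclideanLin (M i) (ξ.1 i), ξ.2⟩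
      map_add' := by intro a b; ext1; funext i; simp; rfl
      map_smul' := by intro c a; ext1; funext i; simp }

/-- The composition `S T` of unbounded operators, with domain `{ξ ∈ dom T : T ξ ∈ dom S}`. -/
noncomputable def opMul {H : Type*} [AddCommGroup H] [Module 𝕜 H] (S T : H →ₗ.[𝕜] H) :
    H →ₗ.[𝕜] H where
  domain := (S.domain.comap T.toFun).map T.domain.subtype
  toFun :=
    { toFun := fun ξ =>
        S ⟨T ⟨ξ.1, by obtain ⟨η, -, h⟩ := ξ.2; rw [← h]; exact η.2⟩, by
          obtain ⟨η, hη, h⟩ := ξ.2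
          have : (⟨ξ.1, by rw [← h]; exact η.2⟩ : T.domain) = η := Subtype.ext h.symm
          rw [this]; exact hη⟩
      map_add' := by
        intro a b
        rw [← LinearPMap.map_add]
        congr 1
        ext1
        exact T.map_add ⟨a.1, _⟩ ⟨b.1, _⟩
      map_smul' := by
        intro c a
        rw [RingHom.id_apply, ← LinearPMap.map_smul]
        congr 1
        ext1
        exact T.map_smul c ⟨a.1, _⟩ }

/-- The commutator `[S, T] = S T - T S`. -/
noncomputable def opCommutator {H : Type*} [AddCommGroup H] [Module 𝕜 H] (S T : H →ₗ.[𝕜] H) :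
    H →ₗ.[𝕜] H :=
  opMul S T - opMul T S

open Classical in
/-- The vector `δ_i ⊗ ε_j` of the standard orthonormal basis. -/
noncomputable def stdVec (i : ι) (j : Fin 2) : SpinorSpace ι 𝕜 :=
  lp.single 2 i (EuclideanSpace.single j (1 : 𝕜))

open Classical in
/-- The diagonal matrix coefficient of `T` at a standard basis vector (`0` if the vector is not in
the domain of `T`). -/
noncomputable def diagCoeff (T : SpinorSpace ι 𝕜 →ₗ.[𝕜] SpinorSpace ι 𝕜) (p : ι × Fin 2) : 𝕜 :=
  if h : stdVec p.1 p.2 ∈ T.domain then inner 𝕜 (stdVec p.1 p.2) (T ⟨stdVec p.1 p.2, h⟩) else 0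

/-- The standard basis lies in the domain of `T` and the series that defines the trace converges
absolutely. -/
def HasTrace (T : SpinorSpace ι 𝕜 →ₗ.[𝕜] SpinorSpace ι 𝕜) : Prop :=
  (∀ p : ι × Fin 2, stdVec p.1 p.2 ∈ T.domain) ∧ Summable (diagCoeff T)

/-- The trace of `T`. -/
noncomputable def opTrace (T : SpinorSpace ι 𝕜 →ₗ.[𝕜] SpinorSpace ι 𝕜) : 𝕜 :=
  ∑' p : ι × Fin 2, diagCoeff T p

end Operators

/-! ### The spectral triples and the form `Q_s` -/

section SpectralTriple

variable {k : ℕ} [NeZero k] {V : Type u} {A : Fin k → Matrix V V ℕ}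

/-- The admissible values at `γ` of a choice function: pairs of infinite paths in `[γ]` whose
distance is the diameter of `[γ]`. -/
abbrev ChoicePair (w : FinPath A → ℝ) (γ : FinPath A) : Type u :=
  {p : InfPath A × InfPath A // p.1 ∈ cylinder γ ∧ p.2 ∈ cylinder γ ∧
    weightDist w p.1 p.2 = cylinderDiam w γ}

/-- The space `Ξ` of choice functions. -/
abbrev ChoiceFun (w : FinPath A → ℝ) : Type u := ∀ γ : FinPath A, ChoicePair w γ

/-- The measure `ν_γ = (μ × μ) / ∑_{(e,e') ∈ ext_1(γ)} μ[γe] μ[γe']` on the values at `γ`. -/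
noncomputable def choiceMeasureAt [Fintype V] (w : FinPath A → ℝ) (μ : Measure (InfPath A))
    (γ : FinPath A) : Measure (ChoicePair w γ) :=
  (ENNReal.ofReal (extSum μ γ))⁻¹ • (μ.prod μ).comap Subtype.val

/-- The measure `ν` on `Ξ`: the product of the measures `ν_γ`. -/
noncomputable def choiceMeasure [Fintype V] (w : FinPath A → ℝ) (μ : Measure (InfPath A)) :
    Measure (ChoiceFun w) :=
  Measure.infinitePi (choiceMeasureAt w μ)

variable (𝕜 : Type*) [RCLike 𝕜]

/-- The block of the Dirac-type operator at `γ`. -/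
noncomputable def diracBlock (w : FinPath A → ℝ) (γ : FinPath A) : Matrix (Fin 2) (Fin 2) 𝕜 :=
  ((w γ : 𝕜))⁻¹ • !![0, 1; 1, 0]

/-- The Dirac-type operator `D`. -/
noncomputable def dirac (w : FinPath A → ℝ) :
    SpinorSpace (FinPath A) 𝕜 →ₗ.[𝕜] SpinorSpace (FinPath A) 𝕜 :=
  directSumOp (diracBlock 𝕜 w)

/-- The operator `|D|^{-s}`, by functional calculus on each block of the direct sum `D`. -/
noncomputable def absDiracPow (w : FinPath A → ℝ) (s : ℝ) :
    SpinorSpace (FinPath A) 𝕜 →ₗ.[𝕜] SpinorSpace (FinPath A) 𝕜 :=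
  directSumOp fun γ => cfc (fun x : ℝ => |x| ^ (-s)) (diracBlock 𝕜 w γ)

variable {𝕜}

/-- The representation `π_φ(f)`. -/
noncomputable def choiceRep {w : FinPath A → ℝ} (φ : ChoiceFun w) (f : InfPath A → 𝕜) :
    SpinorSpace (FinPath A) 𝕜 →ₗ.[𝕜] SpinorSpace (FinPath A) 𝕜 :=
  directSumOp fun γ => !![f (φ γ).1.1, 0; 0, f (φ γ).1.2]

/-- The operator `|D|^{-s} [D, π_φ(f)]^* [D, π_φ(g)]`. -/
noncomputable def energyOp {w : FinPath A → ℝ} (s : ℝ) (φ : ChoiceFun w) (f g : InfPath A → 𝕜) :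
    SpinorSpace (FinPath A) 𝕜 →ₗ.[𝕜] SpinorSpace (FinPath A) 𝕜 :=
  opMul (absDiracPow 𝕜 w s)
    (opMul (opCommutator (dirac 𝕜 w) (choiceRep φ f)).adjoint
      (opCommutator (dirac 𝕜 w) (choiceRep φ g)))

/-- The integral that defines `Q_s(f, g)` makes sense: the trace exists for `ν`-almost every choice
function and is an integrable function of it. -/
def SpectralFormDefined [Fintype V] (w : FinPath A → ℝ) (s : ℝ) (μ : Measure (InfPath A))
    (f g : InfPath A → 𝕜) : Prop :=
  (∀ᵐ φ ∂(choiceMeasure w μ), HasTrace (energyOp s φ f g)) ∧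
    Integrable (fun φ => opTrace (energyOp s φ f g)) (choiceMeasure w μ)

/-- The form `Q_s(f, g) = (1/2) ∫_Ξ Tr(|D|^{-s} [D, π_φ(f)]^* [D, π_φ(g)]) dν(φ)`. -/
noncomputable def spectralForm [Fintype V] (w : FinPath A → ℝ) (s : ℝ) (μ : Measure (InfPath A))
    (f g : InfPath A → 𝕜) : 𝕜 :=
  (1 / 2 : 𝕜) * ∫ φ, opTrace (energyOp s φ f g) ∂(choiceMeasure w μ)

end SpectralTriple

/-! ### Block diagonal operators -/

section BlockOperators

variable {ι 𝕜 : Type*} [RCLike 𝕜]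

/-! Every operator involved is block diagonal over the finite paths, with 2×2 blocks. On the block
at γ, `|D|^{-s}` is the scalar `w(γ)^s`, and `[D, π_φ(f)]^*[D, π_φ(g)]` is `w(γ)^{-2}` times the
scalar `conj(f(x) - f(y)) (g(x) - g(y))`, where `(x, y) = φ(γ)`. Half the trace is therefore a
series over γ of terms that depend on φ only through `φ(γ)` (`opTrace_energyOp`).

Since δ < 1 and all ρ_i > 1, the weight shrinks by a factor below 1 along each edge. The pairs
realizing the diameter of `[γ]` are then exactly those that split at `s(γ)` (`admissible_iff`), and
`φ(γ)` is distributed as the normalized restriction of `μ × μ` to these pairs. The sets of pairs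
with `x ∧ y = γ` are disjoint for different γ, so `J_s(x ∧ y) dμ dμ` is the sum over γ of
`w(γ)^{s-2}` times the law of `φ(γ)` (`jumpMeasure_eq_sum_map`). Exchanging sum and integral gives
the equality of forms; for `f = g` all terms are nonnegative, so finiteness on one side is
equivalent to finiteness on the other. Only the one-coordinate marginals of ν enter.

For the closure, the jump form is the squared norm of `f ↦ f(x) - f(y)`, an operator from `L²(μ)` to
`L²` of the jump measure whose graph is closed. What remains is that the cylinder span is a core
(`eq_zero_of_orthogonal_cylinderSpan`): averaging over the cylinders of a fixed level is an
orthogonal projection for the graph inner product, so a graph vector orthogonal to all step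
functions has mean zero on every cylinder and vanishes. -/

open Classical in
/-- `T` acts as the matrix `M i` on the summand with index `i`, and its domain contains all vectors
that are supported in a single summand. -/
structure IsBlockOp (T : SpinorSpace ι 𝕜 →ₗ.[𝕜] SpinorSpace ι 𝕜)
    (M : ι → Matrix (Fin 2) (Fin 2) 𝕜) : Prop where
  single_mem : ∀ (i : ι) (v : EuclideanSpace 𝕜 (Fin 2)),
    (lp.single 2 i v : SpinorSpace ι 𝕜) ∈ T.domain
  apply_eq : ∀ (ξ : T.domain) (i : ι), T ξ i = Matrix.toEuclideanLin (M i) (ξ.1 i)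

namespace IsBlockOp

variable {S T : SpinorSpace ι 𝕜 →ₗ.[𝕜] SpinorSpace ι 𝕜} {M N : ι → Matrix (Fin 2) (Fin 2) 𝕜}

open Classical in
theorem apply_single (h : IsBlockOp T M) (i : ι) (v : EuclideanSpace 𝕜 (Fin 2)) :
    T ⟨lp.single 2 i v, h.single_mem i v⟩ = lp.single 2 i (Matrix.toEuclideanLin (M i) v) := by
  ext1
  funext j
  rw [h.apply_eq]
  by_cases hj : j = i
  · subst hj
    simp only [lp.single_apply_self]
  · simp only [lp.single_apply_ne _ _ _ hj, map_zero]

theorem directSumOp (M : ι → Matrix (Fin 2) (Fin 2) 𝕜) : IsBlockOp (directSumOp M) M where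
  single_mem i v := by
    classical
    have h : (fun j => Matrix.toEuclideanLin (M j) ((lp.single 2 i v : SpinorSpace ι 𝕜) j))
        = ((lp.single 2 i (Matrix.toEuclideanLin (M i) v) : SpinorSpace ι 𝕜) : ∀ _, _) := by
      funext j
      by_cases hj : j = i
      · subst hj
        simp only [lp.single_apply_self]
      · simp only [lp.single_apply_ne _ _ _ hj, map_zero]
    change Memℓp (fun j => Matrix.toEuclideanLin (M j) ((lp.single 2 i v : SpinorSpace ι 𝕜) j)) 2
    rw [h]
    exact lp.memℓp _
  apply_eq _ _ := rfl

theorem opMul (hS : IsBlockOp S M) (hT : IsBlockOp T N) :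
    IsBlockOp (opMul S T) (fun i => M i * N i) where
  single_mem i v := by
    refine ⟨⟨_, hT.single_mem i v⟩, ?_, rfl⟩
    change T ⟨_, hT.single_mem i v⟩ ∈ S.domain
    rw [hT.apply_single]
    exact hS.single_mem _ _
  apply_eq ξ i := by
    change S _ i = _
    rw [hS.apply_eq, hT.apply_eq]
    simp [Matrix.toLpLin_apply]

theorem sub (hS : IsBlockOp S M) (hT : IsBlockOp T N) :
    IsBlockOp (S - T) (fun i => M i - N i) where
  single_mem i v := by
    rw [LinearPMap.sub_domain]
    exact ⟨hS.single_mem i v, hT.single_mem i v⟩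
  apply_eq ξ i := by
    rw [LinearPMap.sub_apply, lp.coeFn_sub, Pi.sub_apply, hS.apply_eq, hT.apply_eq]
    simp

theorem opCommutator (hS : IsBlockOp S M) (hT : IsBlockOp T N) :
    IsBlockOp (opCommutator S T) (fun i => M i * N i - N i * M i) :=
  (hS.opMul hT).sub (hT.opMul hS)

/-- Finitely supported vectors are dense. Without a dense domain the adjoint would carry no
information. -/
theorem dense_domain (hT : IsBlockOp T M) : Dense (T.domain : Set (SpinorSpace ι 𝕜)) := by
  classical
  intro ξ
  refine mem_closure_of_tendsto (lp.hasSum_single (by norm_num) ξ)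
    (Eventually.of_forall fun s => ?_)
  exact Submodule.sum_mem _ fun i _ => hT.single_mem i _

/-- Pairing with vectors supported in one summand isolates the corresponding block, where the
adjoint is the conjugate transpose. -/
theorem adjoint (hT : IsBlockOp T M) : IsBlockOp T.adjoint (fun i => (M i).conjTranspose) where
  single_mem i v := by
    classical
    refine LinearPMap.mem_adjoint_domain_of_exists _
      ⟨lp.single 2 i (Matrix.toEuclideanLin (M i).conjTranspose v), fun ξ => ?_⟩
    rw [lp.inner_single_left, lp.inner_single_left, hT.apply_eq,
      Matrix.toEuclideanLin_conjTranspose_eq_adjoint, LinearMap.adjoint_inner_left]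
  apply_eq ξ i := by
    classical
    refine ext_inner_right 𝕜 fun v => ?_
    have h := LinearPMap.adjoint_isFormalAdjoint hT.dense_domain ξ ⟨_, hT.single_mem i v⟩
    rw [hT.apply_single, lp.inner_single_right, lp.inner_single_right] at h
    rw [h, Matrix.toEuclideanLin_conjTranspose_eq_adjoint, LinearMap.adjoint_inner_left]

theorem diagCoeff_eq (hT : IsBlockOp T M) (p : ι × Fin 2) :
    diagCoeff T p = M p.1 p.2 p.2 := by
  have h : (stdVec p.1 p.2 : SpinorSpace ι 𝕜) ∈ T.domain := hT.single_mem _ _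
  rw [diagCoeff, dif_pos h]
  classical
  have h1 := hT.apply_single p.1 (EuclideanSpace.single p.2 (1 : 𝕜))
  change T ⟨stdVec p.1 p.2, h⟩ = _ at h1
  rw [h1, stdVec, lp.inner_single_left, lp.single_apply_self]
  simp [EuclideanSpace.inner_single_left, Matrix.toLpLin_apply]

/-- The domain condition in `HasTrace` is automatic for block operators, so only summability
remains. -/
theorem hasTrace_iff (hT : IsBlockOp T M) :
    HasTrace T ↔ Summable fun p : ι × Fin 2 => M p.1 p.2 p.2 := by
  rw [HasTrace, show diagCoeff T = _ from funext hT.diagCoeff_eq]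
  exact and_iff_right fun p => hT.single_mem _ _

theorem opTrace_eq (hT : IsBlockOp T M) : opTrace T = ∑' p : ι × Fin 2, M p.1 p.2 p.2 := by
  rw [opTrace, show diagCoeff T = _ from funext hT.diagCoeff_eq]

end IsBlockOp

end BlockOperators

/-! ### The blocks of the Dirac operator and of the energy operator -/

section DiracBlock

variable {k : ℕ} [NeZero k] {V : Type u} {A : Fin k → Matrix V V ℕ} (𝕜 : Type*) [RCLike 𝕜]

theorem diracBlock_isSelfAdjoint (w : FinPath A → ℝ) (γ : FinPath A) :
    IsSelfAdjoint (diracBlock 𝕜 w γ) := by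
  rw [isSelfAdjoint_iff, Matrix.star_eq_conjTranspose, diracBlock]
  ext i j
  fin_cases i <;> fin_cases j <;> simp

theorem diracBlock_sq (w : FinPath A → ℝ) (γ : FinPath A) :
    diracBlock 𝕜 w γ ^ 2 = algebraMap ℝ _ ((w γ)⁻¹ ^ 2) := by
  rw [diracBlock, Algebra.algebraMap_eq_smul_one]
  ext i j
  fin_cases i <;> fin_cases j <;>
    simp [pow_two, RCLike.real_smul_eq_coe_mul]

/-- The block squares to the scalar `w(γ)^{-2}`, so every spectral value has absolute value `1 /
w(γ)` and the function is constant on the spectrum. -/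
theorem cfc_diracBlock {w : FinPath A → ℝ} {γ : FinPath A} (hw : 0 < w γ) (s : ℝ) :
    cfc (fun x : ℝ => |x| ^ (-s)) (diracBlock 𝕜 w γ) = algebraMap ℝ _ (w γ ^ s) := by
  rw [← cfc_const (w γ ^ s) (diracBlock 𝕜 w γ) (diracBlock_isSelfAdjoint 𝕜 w γ)]
  refine cfc_congr fun x hx => ?_
  have h1 : x ^ 2 ∈ spectrum ℝ (diracBlock 𝕜 w γ ^ 2) := spectrum.pow_mem_pow _ 2 hx
  rw [diracBlock_sq, spectrum.scalar_eq, Set.mem_singleton_iff] at h1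
  have h2 : |x| = (w γ)⁻¹ := by
    rw [← sq_eq_sq₀ (abs_nonneg x) (by positivity), sq_abs, h1]
  change |x| ^ (-s) = _
  rw [h2, Real.inv_rpow hw.le, Real.rpow_neg hw.le, inv_inv]

variable {𝕜}

/-- The contribution of `γ` to the trace of `|D|^{-s} [D, π_φ(f)]^* [D, π_φ(g)]` is twice this
number. -/
noncomputable def blockEnergy (w : FinPath A → ℝ) (s : ℝ) (f g : InfPath A → 𝕜) (γ : FinPath A)
    (p : InfPath A × InfPath A) : 𝕜 :=
  ((w γ ^ (s - 2) : ℝ) : 𝕜) * (starRingEnd 𝕜 (f p.1 - f p.2) * (g p.1 - g p.2))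

/-- The commutator block is antidiagonal with entries `±(f(x) - f(y)) / w(γ)`. In the product of two
such blocks the signs cancel, which makes both diagonal entries equal. -/
theorem energyOp_isBlockOp {w : FinPath A → ℝ} (hw : ∀ γ, 0 < w γ) (s : ℝ) (φ : ChoiceFun w)
    (f g : InfPath A → 𝕜) :
    ∃ M, IsBlockOp (energyOp s φ f g) M ∧
      ∀ γ j, M γ j j = blockEnergy w s f g γ (φ γ).1 := by
  refine ⟨_, (IsBlockOp.directSumOp _).opMul
    (((IsBlockOp.directSumOp _).opCommutator (IsBlockOp.directSumOp _)).adjoint.opMul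
      ((IsBlockOp.directSumOp _).opCommutator (IsBlockOp.directSumOp _))), fun γ j => ?_⟩
  have h : (w γ) ^ (s - 2) = w γ ^ s * ((w γ)⁻¹ * (w γ)⁻¹) := by
    rw [Real.rpow_sub (hw γ), div_eq_mul_inv]
    congr 1
    rw [Real.rpow_two, pow_two, mul_inv]
  rw [cfc_diracBlock 𝕜 (hw γ), diracBlock, blockEnergy, h, Algebra.algebraMap_eq_smul_one]
  fin_cases j <;>
    simp [Matrix.mul_apply, Fin.sum_univ_two,
      RCLike.real_smul_eq_coe_mul] <;> ring

theorem hasTrace_energyOp_iff {w : FinPath A → ℝ} (hw : ∀ γ, 0 < w γ) (s : ℝ) (φ : ChoiceFun w)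
    (f g : InfPath A → 𝕜) :
    HasTrace (energyOp s φ f g) ↔ Summable fun γ => blockEnergy w s f g γ (φ γ).1 := by
  obtain ⟨M, hM, h⟩ := energyOp_isBlockOp hw s φ f g
  rw [hM.hasTrace_iff]
  simp only [h]
  refine ⟨fun hs => ?_, fun hs => ?_⟩
  · exact hs.comp_injective (i := fun γ => (γ, (0 : Fin 2))) fun a b hab => congrArg Prod.fst hab
  · rw [← (Equiv.prodComm (Fin 2) (FinPath A)).summable_iff]
    exact (summable_norm_iff.1 (summable_prod_of_nonneg (fun _ => norm_nonneg _) |>.2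
      ⟨fun _ => hs.norm, (hasSum_fintype _).summable⟩))

theorem opTrace_energyOp {w : FinPath A → ℝ} (hw : ∀ γ, 0 < w γ) (s : ℝ) (φ : ChoiceFun w)
    (f g : InfPath A → 𝕜) :
    opTrace (energyOp s φ f g) = 2 * ∑' γ, blockEnergy w s f g γ (φ γ).1 := by
  obtain ⟨M, hM, h⟩ := energyOp_isBlockOp hw s φ f g
  rw [hM.opTrace_eq]
  simp only [h]
  by_cases hs : Summable fun γ => blockEnergy w s f g γ (φ γ).1
  · have h2 := (hasTrace_energyOp_iff hw s φ f g).2 hs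
    rw [hM.hasTrace_iff] at h2
    simp only [h] at h2
    rw [h2.tsum_prod' fun γ => (hasSum_fintype _).summable]
    simp [tsum_mul_left]
  -- Without summability both sides are the default value 0 of `tsum`.
  · have h2 := fun h' => hs ((hasTrace_energyOp_iff hw s φ f g).1 h')
    rw [hM.hasTrace_iff] at h2
    simp only [h] at h2
    rw [tsum_eq_zero_of_not_summable h2, tsum_eq_zero_of_not_summable hs, mul_zero]

end DiracBlock

/-! ### Paths -/

section Paths

variable {k : ℕ} [NeZero k] {V : Type u} {A : Fin k → Matrix V V ℕ}

namespace InfPath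

/-- The edge of `x` between the levels `n` and `n + 1`. -/
def extEdge (x : InfPath A) (n : ℕ) : (x.take n).Ext := ⟨x.vert (n + 1), x.edge n⟩

theorem take_succ (x : InfPath A) (n : ℕ) : x.take (n + 1) = (x.take n).extend (x.extEdge n) := rfl

end InfPath

/-- The type of an extending edge depends on the path, hence the heterogeneous equality. -/
theorem FinPath.extend_eq {γ γ' : FinPath A} {e : γ.Ext} {e' : γ'.Ext}
    (h : γ.extend e = γ'.extend e') : γ = γ' ∧ HEq e e' := by
  obtain ⟨n, p, a⟩ := γ
  obtain ⟨n', p', a'⟩ := γ'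
  obtain ⟨q, e⟩ := e
  obtain ⟨q', e'⟩ := e'
  simp only [FinPath.extend, Sigma.mk.injEq, Nat.add_right_cancel_iff] at h
  obtain ⟨rfl, h⟩ := h
  have h := eq_of_heq h
  simp only [Sigma.mk.injEq] at h
  obtain ⟨rfl, h⟩ := h
  have h := eq_of_heq h
  injection h with h1 h2 h3 h4 h5
  subst h2
  have h3 := eq_of_heq h3
  subst h3
  have h5 := eq_of_heq h5
  subst h5
  exact ⟨rfl, HEq.rfl⟩

theorem FinPath.extend_injective (γ : FinPath A) : Function.Injective γ.extend :=
  fun _ _ h => eq_of_heq (FinPath.extend_eq h).2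

namespace InfPath

theorem take_eq_of_succ {x y : InfPath A} {n : ℕ} (h : x.take (n + 1) = y.take (n + 1)) :
    x.take n = y.take n := by
  rw [take_succ, take_succ] at h
  exact (FinPath.extend_eq h).1

theorem take_eq_of_le {x y : InfPath A} {m n : ℕ} (hmn : m ≤ n) (h : x.take n = y.take n) :
    x.take m = y.take m := by
  induction n, hmn using Nat.le_induction with
  | base => exact h
  | succ n _ ih => exact ih (take_eq_of_succ h)

theorem eq_of_forall_take {x y : InfPath A} (h : ∀ n, x.take n = y.take n) : x = y := by
  have hv : x.vert = y.vert := funext fun n => congrArg (fun γ : FinPath A => γ.src) (h n)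
  obtain ⟨v, e⟩ := x
  obtain ⟨v', e'⟩ := y
  change v = v' at hv
  subst hv
  congr 1
  funext n
  have h0 := h (n + 1)
  simp only [take, takeAux, Sigma.mk.injEq, heq_eq_eq, true_and, BPath.snoc.injEq] at h0
  exact h0.2

end InfPath

theorem mem_pathCylinder {x : InfPath A} {γ : FinPath A} : x ∈ cylinder γ ↔ x.take γ.len = γ := Iff.rfl

theorem mem_cylinder_take (x : InfPath A) (n : ℕ) : x ∈ cylinder (x.take n) := rfl

theorem cylinder_extend_subset (γ : FinPath A) (e : γ.Ext) :
    cylinder (γ.extend e) ⊆ cylinder γ :=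
  fun x hx => (FinPath.extend_eq (γ := x.take γ.len) (e := x.extEdge γ.len) hx).1

theorem exists_mem_cylinder_extend {γ : FinPath A} {x : InfPath A} (hx : x ∈ cylinder γ) :
    ∃ e : γ.Ext, x ∈ cylinder (γ.extend e) := by
  rw [mem_pathCylinder] at hx
  generalize hn : γ.len = n at hx
  subst hx
  exact ⟨x.extEdge n, mem_cylinder_take x (n + 1)⟩

theorem cylinder_disjoint_of_len {γ γ' : FinPath A} (h : γ ≠ γ') (hl : γ.len = γ'.len) :
    Disjoint (cylinder γ) (cylinder γ') := by
  rw [Set.disjoint_left]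
  intro x hx hx'
  rw [mem_pathCylinder] at hx hx'
  exact h (by rw [← hx, ← hx', hl])

theorem extend_eq_of_mem {γ : FinPath A} {e e' : γ.Ext} {x : InfPath A}
    (h : x ∈ cylinder (γ.extend e)) (h' : x ∈ cylinder (γ.extend e')) : e = e' := by
  by_contra hne
  exact Set.disjoint_left.1 (cylinder_disjoint_of_len
    (fun h0 => hne (γ.extend_injective h0)) rfl) h h'

/-- Two cylinders with a common point x are cylinders of initial segments of x, hence nested. -/
theorem isPiSystem_cylinder : IsPiSystem (Set.range (cylinder (A := A))) := by
  rintro _ ⟨γ, rfl⟩ _ ⟨γ', rfl⟩ ⟨x, hx, hx'⟩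
  rw [mem_pathCylinder] at hx hx'
  have key : ∀ m n, m ≤ n → cylinder (x.take m) ∩ cylinder (x.take n) = cylinder (x.take n) :=
    fun m n hmn => Set.inter_eq_right.2 fun y hy =>
      InfPath.take_eq_of_le hmn (show y.take n = x.take n from hy)
  rw [← hx, ← hx']
  rcases le_total γ.len γ'.len with h | h
  · rw [key _ _ h]
    exact ⟨_, rfl⟩
  · rw [Set.inter_comm, key _ _ h]
    exact ⟨_, rfl⟩

/-- The pairs of infinite paths that agree along `γ` and split at `s(γ)`. -/
def meetSet (γ : FinPath A) : Set (InfPath A × InfPath A) :=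
  {p | p.1 ≠ p.2 ∧ meet p.1 p.2 = some γ}

theorem exists_take_split {x y : InfPath A} (hne : x ≠ y) (h0 : x.take 0 = y.take 0) :
    ∃ n, x.take n = y.take n ∧ x.take (n + 1) ≠ y.take (n + 1) := by
  by_contra hcon
  push Not at hcon
  exact hne (InfPath.eq_of_forall_take fun n => Nat.rec h0 (fun n ih => hcon n ih) n)

theorem meet_eq_of_split {x y : InfPath A} {n : ℕ} (h : x.take n = y.take n)
    (h' : x.take (n + 1) ≠ y.take (n + 1)) : meet x y = some (x.take n) := by
  -- The levels of agreement form a bounded initial segment, so the `sSup` in `meet` is its true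
  -- maximum and not a default value.
  have hs : {m | x.take m = y.take m} = Set.Iic n := by
    ext m
    refine ⟨fun hm => ?_, fun hm => InfPath.take_eq_of_le hm h⟩
    by_contra hlt
    exact h' (InfPath.take_eq_of_le (by simpa using hlt) hm)
  rw [meet, if_pos (InfPath.take_eq_of_le (Nat.zero_le n) h), hs, csSup_Iic]

theorem meet_eq_none {x y : InfPath A} (h : x.take 0 ≠ y.take 0) : meet x y = none := by
  rw [meet, if_neg h]

theorem mem_meetSet_of_split {x y : InfPath A} {n : ℕ} (h : x.take n = y.take n)
    (h' : x.take (n + 1) ≠ y.take (n + 1)) : (x, y) ∈ meetSet (x.take n) :=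
  ⟨fun hxy => h' (by rw [show x = y from hxy]), meet_eq_of_split h h'⟩

theorem mem_meetSet_iff {γ : FinPath A} {p : InfPath A × InfPath A} :
    p ∈ meetSet γ ↔ p.1 ∈ cylinder γ ∧ p.2 ∈ cylinder γ ∧
      p.1.take (γ.len + 1) ≠ p.2.take (γ.len + 1) := by
  obtain ⟨x, y⟩ := p
  constructor
  · rintro ⟨hne, hm⟩
    simp only at hne hm
    by_cases h0 : x.take 0 = y.take 0
    · obtain ⟨n, h, h'⟩ := exists_take_split hne h0
      rw [meet_eq_of_split h h', Option.some.injEq] at hm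
      subst hm
      exact ⟨rfl, h.symm, h'⟩
    · rw [meet_eq_none h0] at hm
      exact absurd hm (by simp)
  · rintro ⟨hx, hy, h'⟩
    rw [mem_pathCylinder] at hx hy
    have h := mem_meetSet_of_split (hx.trans hy.symm) h'
    rwa [hx] at h

/-- Splitting at `s(γ)` means continuing along two different edges. This yields both the
measurability of the set and its measure. -/
theorem meetSet_eq_iUnion (γ : FinPath A) :
    meetSet γ = ⋃ p : {p : γ.Ext × γ.Ext // p.1 ≠ p.2},
      cylinder (γ.extend p.1.1) ×ˢ cylinder (γ.extend p.1.2) := by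
  ext ⟨x, y⟩
  rw [mem_meetSet_iff, Set.mem_iUnion]
  constructor
  · rintro ⟨hx, hy, h⟩
    obtain ⟨e, he⟩ := exists_mem_cylinder_extend hx
    obtain ⟨e', he'⟩ := exists_mem_cylinder_extend hy
    refine ⟨⟨(e, e'), fun hee => ?_⟩, he, he'⟩
    obtain rfl : e = e' := hee
    exact h ((mem_pathCylinder.1 he).trans (mem_pathCylinder.1 he').symm)
  · rintro ⟨⟨⟨e, e'⟩, hne⟩, he, he'⟩
    refine ⟨cylinder_extend_subset _ _ he, cylinder_extend_subset _ _ he', fun h => hne ?_⟩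
    refine extend_eq_of_mem he (?_ : x.take (γ.len + 1) = _)
    exact h.trans he'

theorem meetSet_disjoint {γ γ' : FinPath A} (h : γ ≠ γ') : Disjoint (meetSet γ) (meetSet γ') := by
  rw [Set.disjoint_left]
  rintro p ⟨_, hp⟩ ⟨_, hp'⟩
  exact h (Option.some.inj (hp.symm.trans hp'))

theorem jumpWeight_of_mem (J : FinPath A → ℝ) {γ : FinPath A} {x y : InfPath A}
    (h : (x, y) ∈ meetSet γ) : jumpWeight J x y = J γ := by
  rw [jumpWeight, if_neg h.1, show meet x y = some γ from h.2]
  rfl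

theorem jumpWeight_of_notMem (J : FinPath A → ℝ) {x y : InfPath A}
    (h : ∀ γ, (x, y) ∉ meetSet γ) : jumpWeight J x y = 0 := by
  rw [jumpWeight]
  split_ifs with hxy
  · rfl
  · cases hm : meet x y with
    | none => rfl
    | some γ => exact absurd ⟨hxy, hm⟩ (h γ)

theorem weightDist_of_mem (w : FinPath A → ℝ) {γ : FinPath A} {x y : InfPath A}
    (h : (x, y) ∈ meetSet γ) : weightDist w x y = w γ := by
  rw [weightDist, if_neg h.1, show meet x y = some γ from h.2]
  rfl

/-! ### Countability and measurability for a finite vertex set -/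

section Fintype

variable [Finite V]

instance (n : ℕ) : Finite (Σ q : V, BPath A n q) := by
  induction n with
  | zero =>
    refine Finite.of_surjective (α := V) (fun q => ⟨q, BPath.vertex q⟩) ?_
    rintro ⟨q, ⟨⟩⟩
    exact ⟨q, rfl⟩
  | succ n ih =>
    refine Finite.of_surjective
      (α := Σ a : (Σ q : V, BPath A n q), Σ q : V, Fin (A (Fin.ofNat k n) a.1 q))
      (fun t => ⟨t.2.1, BPath.snoc t.1.2 t.2.1 t.2.2⟩) ?_
    rintro ⟨q, h⟩
    cases h with
    | snoc γ _ e => exact ⟨⟨⟨_, γ⟩, ⟨q, e⟩⟩, rfl⟩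

instance : Countable (FinPath A) := inferInstanceAs (Countable (Σ n, Σ q : V, BPath A n q))

theorem measurableSet_meetSet (γ : FinPath A) : MeasurableSet (meetSet γ) := by
  rw [meetSet_eq_iUnion]
  exact MeasurableSet.iUnion fun p =>
    (measurableSet_cylinder _).prod (measurableSet_cylinder _)

instance : SecondCountableTopology (InfPath A) :=
  ⟨Set.range cylinder, Set.countable_range _, rfl⟩

theorem borel_eq_generateFrom_cylinder :
    borel (InfPath A) = MeasurableSpace.generateFrom (Set.range cylinder) :=
  borel_eq_generateFrom_of_subbasis rfl

theorem measurable_jumpWeight (J : FinPath A → ℝ) :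
    Measurable fun p : InfPath A × InfPath A => jumpWeight J p.1 p.2 := by
  intro B _
  -- The weight is constant on each of the countably many meet sets and 0 off their union, that is,
  -- on the diagonal and on pairs with different ranges.
  have h : (fun p : InfPath A × InfPath A => jumpWeight J p.1 p.2) ⁻¹' B =
      (⋃ γ ∈ {γ | J γ ∈ B}, meetSet γ) ∪ ((⋃ γ, meetSet γ)ᶜ ∩ {_p | (0 : ℝ) ∈ B}) := by
    ext ⟨x, y⟩
    simp only [Set.mem_preimage, Set.mem_union, Set.mem_iUnion, Set.mem_inter_iff,
      Set.mem_compl_iff, Set.mem_ofPred_eq]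
    by_cases hex : ∃ γ, (x, y) ∈ meetSet γ
    · obtain ⟨γ, hγ⟩ := hex
      rw [jumpWeight_of_mem J hγ]
      constructor
      · exact fun h => Or.inl ⟨γ, h, hγ⟩
      · rintro (⟨γ', h, h'⟩ | ⟨h, -⟩)
        · rwa [Option.some.inj (h'.2.symm.trans hγ.2)] at h
        · exact absurd ⟨γ, hγ⟩ h
    · rw [jumpWeight_of_notMem J fun γ hγ => hex ⟨γ, hγ⟩]
      constructor
      · exact fun h => Or.inr ⟨hex, h⟩
      · rintro (⟨γ', h, h'⟩ | ⟨-, h⟩)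
        · exact absurd ⟨γ', h'⟩ hex
        · exact h
  rw [h]
  exact (MeasurableSet.biUnion (Set.to_countable _) fun γ _ => measurableSet_meetSet γ).union
    ((MeasurableSet.iUnion measurableSet_meetSet).compl.inter (MeasurableSet.const _))

end Fintype

end Paths

/-! ### Weights and the product measure on choice functions -/

section Weights

variable {k : ℕ} [NeZero k] {V : Type u} {A : Fin k → Matrix V V ℕ} [Fintype V] [DecidableEq V]

theorem levelProd_pos (hrho : ∀ i, 1 < rho A i) (n : ℕ) : 0 < levelProd A n :=
  Finset.prod_pos fun i _ => pow_pos (zero_lt_one.trans (hrho i)) _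

/-- The left side counts the levels `j ≤ n` with `j ≡ i` modulo k; it exceeds the count for `j < n`
only if `i = n % k`. The proof separates the case where `n + 1` completes a period. -/
theorem Nat.succ_div_add_ite {k i : ℕ} (hi : i < k) (n : ℕ) :
    (n + 1) / k + (if i < (n + 1) % k then 1 else 0) =
      n / k + (if i < n % k then 1 else 0) + if i = n % k then 1 else 0 := by
  have hk : 0 < k := by omega
  have hlt := Nat.mod_lt n hk
  have hn := Nat.div_add_mod n k
  by_cases h : n % k + 1 = k
  · have h1 : n + 1 = k * (n / k + 1) := by rw [Nat.mul_add]; omega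
    have h2 : (n + 1) / k = n / k + 1 := by rw [h1, Nat.mul_div_cancel_left _ hk]
    have h3 : (n + 1) % k = 0 := by rw [h1, Nat.mul_mod_right]
    rw [h2, h3]
    split_ifs <;> omega
  · have h1 : n + 1 = (n % k + 1) + k * (n / k) := by omega
    have h2 : (n + 1) / k = n / k := by
      rw [h1, Nat.add_mul_div_left _ _ hk, Nat.div_eq_of_lt (by omega), zero_add]
    have h3 : (n + 1) % k = n % k + 1 := by
      rw [h1, Nat.add_mul_mod_self_left, Nat.mod_eq_of_lt (by omega)]
    rw [h2, h3]
    split_ifs <;> omega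

theorem levelProd_succ (n : ℕ) :
    levelProd A (n + 1) = levelProd A n * rho A (Fin.ofNat k n) := by
  have h : rho A (Fin.ofNat k n) =
      ∏ i : Fin k, rho A i ^ (if (i : ℕ) = n % k then 1 else 0) := by
    rw [Finset.prod_eq_single (Fin.ofNat k n)]
    · simp
    · intro i _ hi
      rw [if_neg, pow_zero]
      exact fun h => hi (Fin.ext h)
    · simp
  rw [h, levelProd, levelProd, ← Finset.prod_mul_distrib]
  refine Finset.prod_congr rfl fun i _ => ?_
  rw [← pow_add, Nat.succ_div_add_ite i.2]

variable {κ : V → ℝ} {δ : ℝ}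

theorem wt_pos (hrho : ∀ i, 1 < rho A i) (hκ : IsPerronFrobeniusVector A κ) (γ : FinPath A) :
    0 < wt A κ δ γ :=
  mul_pos (Real.rpow_pos_of_pos (levelProd_pos hrho _) _) (hκ.pos _)

/-- If an edge joins p to q, then `κ q` is dominated by a single term of the nonnegative sum `(A_i
κ)_p`. -/
theorem IsPerronFrobeniusVector.le_of_edge (hκ : IsPerronFrobeniusVector A κ) {i : Fin k} {p q : V}
    (e : Fin (A i p q)) : κ q ≤ rho A i * κ p := by
  have h := congrFun (hκ.eigen i) p
  rw [Pi.smul_apply, smul_eq_mul] at h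
  rw [← h, Matrix.mulVec, dotProduct]
  have h1 : κ q ≤ (A i).map (fun m : ℕ => (m : ℝ)) p q * κ q := by
    refine le_mul_of_one_le_left (hκ.pos q).le ?_
    rw [Matrix.map_apply]
    exact_mod_cast e.pos
  exact h1.trans (Finset.single_le_sum
    (f := fun q => (A i).map (fun m : ℕ => (m : ℝ)) p q * κ q)
    (fun j _ => mul_nonneg (by simp) (hκ.pos j).le) (Finset.mem_univ q))

/-- Extending by an edge costs `ρ^{-1/δ}` from the level product and gains at most a factor ρ from
κ. For δ < 1 the resulting exponent is negative, so the weight strictly contracts. -/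
theorem wt_extend_le (hrho : ∀ i, 1 < rho A i) (hκ : IsPerronFrobeniusVector A κ)
    (γ : FinPath A) (e : γ.Ext) :
    wt A κ δ (γ.extend e) ≤ rho A (Fin.ofNat k γ.len) ^ (1 - 1 / δ) * wt A κ δ γ := by
  have hr : 0 < rho A (Fin.ofNat k γ.len) := zero_lt_one.trans (hrho _)
  have hP := levelProd_pos hrho γ.len
  have h : wt A κ δ (γ.extend e) = levelProd A (γ.len + 1) ^ (-1 / δ) * κ e.1 := rfl
  rw [h, levelProd_succ, Real.mul_rpow hP.le hr.le, wt, sub_eq_add_neg, Real.rpow_add hr,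
    Real.rpow_one, ← neg_div]
  have h1 := mul_le_mul_of_nonneg_left (hκ.le_of_edge e.2)
    (mul_pos (Real.rpow_pos_of_pos hP (-1 / δ)) (Real.rpow_pos_of_pos hr (-1 / δ))).le
  linarith

theorem rho_rpow_lt_one (hrho : ∀ i, 1 < rho A i)
    (hδ0 : 0 < δ) (hδ1 : δ < 1) (n : ℕ) :
    rho A (Fin.ofNat k n) ^ (1 - 1 / δ) < 1 :=
  Real.rpow_lt_one_of_one_lt_of_neg (hrho _) (by
    have := one_lt_one_div hδ0 hδ1
    linarith)

theorem wt_extend_lt_wt (hrho : ∀ i, 1 < rho A i) (hκ : IsPerronFrobeniusVector A κ)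
    (hδ0 : 0 < δ) (hδ1 : δ < 1) (γ : FinPath A) (e : γ.Ext) :
    wt A κ δ (γ.extend e) < wt A κ δ γ :=
  (wt_extend_le hrho hκ γ e).trans_lt
    (mul_lt_of_lt_one_left (wt_pos hrho hκ γ) (rho_rpow_lt_one hrho hδ0 hδ1 _))

theorem strictAnti_wt_take (hrho : ∀ i, 1 < rho A i) (hκ : IsPerronFrobeniusVector A κ)
    (hδ0 : 0 < δ) (hδ1 : δ < 1) (x : InfPath A) : StrictAnti fun n => wt A κ δ (x.take n) :=
  strictAnti_nat_of_succ_lt fun n => wt_extend_lt_wt hrho hκ hδ0 hδ1 (x.take n) (x.extEdge n)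

/-- A pair in `[γ]` that does not split at `s(γ)` coincides or splits at least one edge later, where
the contraction has already acted. The bound is uniform, which leaves a gap below `w(γ)`; this
matters because the diameter is a supremum. -/
theorem mem_meetSet_or_weightDist_le (hrho : ∀ i, 1 < rho A i)
    (hκ : IsPerronFrobeniusVector A κ) (hδ0 : 0 < δ) (hδ1 : δ < 1) {γ : FinPath A}
    {x y : InfPath A} (hx : x ∈ cylinder γ) (hy : y ∈ cylinder γ) :
    (x, y) ∈ meetSet γ ∨ weightDist (wt A κ δ) x y ≤
      rho A (Fin.ofNat k γ.len) ^ (1 - 1 / δ) * wt A κ δ γ := by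
  have hr : 0 < rho A (Fin.ofNat k γ.len) := zero_lt_one.trans (hrho _)
  by_cases hxy : x = y
  · right
    rw [weightDist, if_pos hxy]
    exact (mul_pos (Real.rpow_pos_of_pos hr _) (wt_pos hrho hκ γ)).le
  rw [mem_pathCylinder] at hx hy
  obtain ⟨n, h, h'⟩ := exists_take_split hxy
    (InfPath.take_eq_of_le (Nat.zero_le _) (hx.trans hy.symm))
  have hm := mem_meetSet_of_split h h'
  have hn : γ.len ≤ n := by
    by_contra hlt
    exact h' (InfPath.take_eq_of_le (by omega) (hx.trans hy.symm))
  rcases hn.eq_or_lt with hn | hn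
  · left
    rwa [← hn, hx] at hm
  · right
    rw [weightDist_of_mem _ hm]
    refine ((strictAnti_wt_take hrho hκ hδ0 hδ1 x).antitone hn).trans ?_
    have := wt_extend_le (δ := δ) hrho hκ (x.take γ.len) (x.extEdge γ.len)
    rw [← InfPath.take_succ] at this
    refine this.trans (le_of_eq ?_)
    rw [hx]

theorem admissible_iff (hrho : ∀ i, 1 < rho A i) (hκ : IsPerronFrobeniusVector A κ)
    (hδ0 : 0 < δ) (hδ1 : δ < 1)
    (hdiam : ∀ γ : FinPath A, cylinderDiam (wt A κ δ) γ = wt A κ δ γ)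
    (γ : FinPath A) (p : InfPath A × InfPath A) :
    (p.1 ∈ cylinder γ ∧ p.2 ∈ cylinder γ ∧
      weightDist (wt A κ δ) p.1 p.2 = cylinderDiam (wt A κ δ) γ) ↔ p ∈ meetSet γ := by
  rw [hdiam]
  constructor
  · rintro ⟨hx, hy, h⟩
    refine (mem_meetSet_or_weightDist_le hrho hκ hδ0 hδ1 hx hy).resolve_right fun hle => ?_
    rw [h] at hle
    exact hle.not_gt (mul_lt_of_lt_one_left (wt_pos hrho hκ γ) (rho_rpow_lt_one hrho hδ0 hδ1 _))
  · intro h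
    obtain ⟨hx, hy, -⟩ := mem_meetSet_iff.1 h
    exact ⟨hx, hy, weightDist_of_mem _ h⟩

/-- If no pair split at `s(γ)`, the uniform gap would force the diameter of `[γ]` below `w(γ)`. -/
theorem meetSet_nonempty (hrho : ∀ i, 1 < rho A i) (hκ : IsPerronFrobeniusVector A κ)
    (hδ0 : 0 < δ) (hδ1 : δ < 1)
    (hdiam : ∀ γ : FinPath A, cylinderDiam (wt A κ δ) γ = wt A κ δ γ)
    {γ : FinPath A} (hγ : (cylinder γ).Nonempty) : (meetSet γ).Nonempty := by
  by_contra hemp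
  rw [Set.not_nonempty_iff_eq_empty] at hemp
  obtain ⟨x₀, hx₀⟩ := hγ
  have h1 : cylinderDiam (wt A κ δ) γ ≤ rho A (Fin.ofNat k γ.len) ^ (1 - 1 / δ) * wt A κ δ γ := by
    refine csSup_le ⟨_, x₀, hx₀, x₀, hx₀, rfl⟩ ?_
    rintro _ ⟨x, hx, y, hy, rfl⟩
    refine (mem_meetSet_or_weightDist_le hrho hκ hδ0 hδ1 hx hy).resolve_left fun hm => ?_
    rw [hemp] at hm
    exact hm
  rw [hdiam] at h1
  exact h1.not_gt (mul_lt_of_lt_one_left (wt_pos hrho hκ γ) (rho_rpow_lt_one hrho hδ0 hδ1 _))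

theorem IsPerronFrobeniusMeasure.cylinder_pos (hrho : ∀ i, 1 < rho A i)
    (hκ : IsPerronFrobeniusVector A κ) {μ : Measure (InfPath A)}
    (hμ : IsPerronFrobeniusMeasure A κ μ) (γ : FinPath A) : 0 < μ (cylinder γ) := by
  rw [hμ γ, ENNReal.ofReal_pos]
  exact mul_pos (inv_pos.2 (levelProd_pos hrho _)) (hκ.pos _)

end Weights

/-! ### Marginals of the measure on choice functions -/

section ChoiceMeasure

variable {k : ℕ} [NeZero k] {V : Type u} {A : Fin k → Matrix V V ℕ} [Fintype V]
  (μ : Measure (InfPath A)) [IsProbabilityMeasure μ]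

/-- The rectangles that make up the meet set are pairwise disjoint, so the normalizing constant is
exactly its mass. -/
theorem extSum_eq (γ : FinPath A) : extSum μ γ = (μ.prod μ).real (meetSet γ) := by
  classical
  have h : meetSet γ = ⋃ p ∈ (Finset.univ : Finset γ.Ext).offDiag,
      cylinder (γ.extend p.1) ×ˢ cylinder (γ.extend p.2) := by
    rw [meetSet_eq_iUnion]
    ext x
    simp
  rw [h, measureReal_biUnion_finset]
  · simp only [measureReal_prod_prod]
    rfl
  · rintro ⟨a, b⟩ _ ⟨a', b'⟩ _ hne
    rw [Function.onFun, Set.disjoint_left]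
    rintro ⟨x, y⟩ ⟨h1, h2⟩ ⟨h3, h4⟩
    exact hne (Prod.ext (extend_eq_of_mem h1 h3) (extend_eq_of_mem h2 h4))
  · exact fun p _ => (measurableSet_cylinder _).prod (measurableSet_cylinder _)

theorem ofReal_extSum (γ : FinPath A) :
    ENNReal.ofReal (extSum μ γ) = (μ.prod μ) (meetSet γ) := by
  rw [extSum_eq, ofReal_measureReal]

variable {μ}

theorem extSum_pos (hμ : ∀ γ : FinPath A, 0 < μ (cylinder γ)) {γ : FinPath A}
    (h : (meetSet γ).Nonempty) : 0 < extSum μ γ := by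
  rw [← ENNReal.ofReal_pos, ofReal_extSum]
  obtain ⟨p, hp⟩ := h
  rw [meetSet_eq_iUnion, Set.mem_iUnion] at hp
  obtain ⟨e, -⟩ := hp
  refine lt_of_lt_of_le ?_ (measure_mono
    (s := cylinder (γ.extend e.1.1) ×ˢ cylinder (γ.extend e.1.2)) ?_)
  · rw [Measure.prod_prod]
    exact ENNReal.mul_pos (hμ _).ne' (hμ _).ne'
  · rw [meetSet_eq_iUnion]
    exact Set.subset_iUnion (fun p : {p : γ.Ext × γ.Ext // p.1 ≠ p.2} =>
      cylinder (γ.extend p.1.1) ×ˢ cylinder (γ.extend p.1.2)) e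

variable {w : FinPath A → ℝ}
  (hadm : ∀ (γ : FinPath A) (p : InfPath A × InfPath A), (p.1 ∈ cylinder γ ∧ p.2 ∈ cylinder γ ∧
      weightDist w p.1 p.2 = cylinderDiam w γ) ↔ p ∈ meetSet γ)
  (hpos : ∀ γ, 0 < extSum μ γ)

include hadm in
theorem map_val_choiceMeasureAt (γ : FinPath A) :
    (choiceMeasureAt w μ γ).map Subtype.val =
      (ENNReal.ofReal (extSum μ γ))⁻¹ • (μ.prod μ).restrict (meetSet γ) := by
  have hset : {p : InfPath A × InfPath A | p.1 ∈ cylinder γ ∧ p.2 ∈ cylinder γ ∧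
      weightDist w p.1 p.2 = cylinderDiam w γ} = meetSet γ := Set.ext (hadm γ)
  have hemb : MeasurableEmbedding (Subtype.val : ChoicePair w γ → InfPath A × InfPath A) := by
    refine MeasurableEmbedding.subtype_coe (s := {p : InfPath A × InfPath A |
      p.1 ∈ cylinder γ ∧ p.2 ∈ cylinder γ ∧ weightDist w p.1 p.2 = cylinderDiam w γ}) ?_
    rw [hset]
    exact measurableSet_meetSet γ
  rw [choiceMeasureAt, Measure.map_smul, hemb.map_comap, Subtype.range_coe_subtype, hset]

include hadm hpos in
theorem isProbabilityMeasure_choiceMeasureAt (γ : FinPath A) :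
    IsProbabilityMeasure (choiceMeasureAt w μ γ) := by
  have h : IsProbabilityMeasure ((choiceMeasureAt w μ γ).map Subtype.val) := by
    rw [map_val_choiceMeasureAt hadm]
    constructor
    rw [Measure.smul_apply, Measure.restrict_apply_univ, ← ofReal_extSum, smul_eq_mul]
    exact ENNReal.inv_mul_cancel (ENNReal.ofReal_pos.2 (hpos γ)).ne' ENNReal.ofReal_ne_top
  constructor
  rw [← h.measure_univ, Measure.map_apply measurable_subtype_coe MeasurableSet.univ,
    Set.preimage_univ]

theorem measurable_choice (γ : FinPath A) : Measurable fun φ : ChoiceFun w => (φ γ).1 :=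
  measurable_subtype_coe.comp (measurable_pi_apply γ)

include hadm hpos in
-- The only information about ν that the comparison of forms needs. Each factor must be a
-- probability measure for the product to have it as a marginal, which is why `extSum` has to be
-- positive.
theorem map_choiceMeasure (γ : FinPath A) :
    (choiceMeasure w μ).map (fun φ => (φ γ).1) =
      (ENNReal.ofReal (extSum μ γ))⁻¹ • (μ.prod μ).restrict (meetSet γ) := by
  have := isProbabilityMeasure_choiceMeasureAt hadm hpos
  rw [← map_val_choiceMeasureAt hadm γ, ← Measure.infinitePi_map_eval (choiceMeasureAt w μ) γ,
    Measure.map_map measurable_subtype_coe (measurable_pi_apply γ)]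
  rfl

end ChoiceMeasure

/-! ### The jump measure -/

section JumpMeasure

variable {k : ℕ} [NeZero k] {V : Type u} {A : Fin k → Matrix V V ℕ} {𝕜 : Type*} [RCLike 𝕜]

/-- The increment `(x, y) ↦ f(x) - f(y)`. -/
def increment {X E : Type*} [Sub E] (f : X → E) (p : X × X) : E := f p.1 - f p.2

/-- The measure `J(x ∧ y) dμ(x) dμ(y)`. -/
noncomputable def jumpMeasure (J : FinPath A → ℝ) (μ : Measure (InfPath A)) :
    Measure (InfPath A × InfPath A) :=
  (μ.prod μ).withDensity fun p => ENNReal.ofReal (jumpWeight J p.1 p.2)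

theorem jumpMeasure_absolutelyContinuous (J : FinPath A → ℝ) (μ : Measure (InfPath A)) :
    jumpMeasure J μ ≪ μ.prod μ :=
  withDensity_absolutelyContinuous _ _

theorem jumpWeight_nonneg {J : FinPath A → ℝ} (hJ : ∀ γ, 0 ≤ J γ) (x y : InfPath A) :
    0 ≤ jumpWeight J x y := by
  by_cases h : ∃ γ, (x, y) ∈ meetSet γ
  · obtain ⟨γ, hγ⟩ := h
    rw [jumpWeight_of_mem J hγ]
    exact hJ γ
  · rw [jumpWeight_of_notMem J fun γ hγ => h ⟨γ, hγ⟩]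

theorem aestronglyMeasurable_increment {X E : Type*} [MeasurableSpace X] [NormedAddCommGroup E]
    {μ : Measure X} [SFinite μ] {f : X → E} (hf : AEStronglyMeasurable f μ) :
    AEStronglyMeasurable (increment f) (μ.prod μ) :=
  hf.comp_fst.sub hf.comp_snd

variable [Finite V] {μ : Measure (InfPath A)} [IsProbabilityMeasure μ] {J : FinPath A → ℝ}

theorem jumpMeasure_eq_sum (J : FinPath A → ℝ) (μ : Measure (InfPath A)) :
    jumpMeasure J μ =
      Measure.sum fun γ => ENNReal.ofReal (J γ) • (μ.prod μ).restrict (meetSet γ) := by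
  have h : (fun p : InfPath A × InfPath A => ENNReal.ofReal (jumpWeight J p.1 p.2)) =
      ∑' γ, (meetSet γ).indicator fun _ => ENNReal.ofReal (J γ) := by
    funext p
    rw [tsum_apply (Pi.summable.2 fun _ => ENNReal.summable)]
    by_cases hex : ∃ γ, p ∈ meetSet γ
    · obtain ⟨γ, hγ⟩ := hex
      rw [jumpWeight_of_mem J hγ, tsum_eq_single γ, Set.indicator_of_mem hγ]
      intro γ' hne
      exact Set.indicator_of_notMem (fun h => Set.disjoint_left.1 (meetSet_disjoint hne) h hγ) _
    · rw [jumpWeight_of_notMem J fun γ hγ => hex ⟨γ, hγ⟩, ENNReal.ofReal_zero]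
      exact (ENNReal.tsum_eq_zero.2 fun γ =>
        Set.indicator_of_notMem (fun h => hex ⟨γ, h⟩) _).symm
  rw [jumpMeasure, h, withDensity_tsum fun γ =>
    measurable_const.indicator (measurableSet_meetSet γ)]
  congr 1
  funext γ
  rw [withDensity_indicator (measurableSet_meetSet γ), withDensity_const]

theorem lintegral_jumpMeasure {F : InfPath A × InfPath A → ℝ≥0∞}
    (hF : AEMeasurable F (μ.prod μ)) :
    ∫⁻ p, F p ∂(jumpMeasure J μ) =
      ∫⁻ p, ENNReal.ofReal (jumpWeight J p.1 p.2) * F p ∂(μ.prod μ) :=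
  lintegral_withDensity_eq_lintegral_mul₀ (measurable_jumpWeight J).ennreal_ofReal.aemeasurable hF

theorem lintegral_jumpMeasure_increment {f : InfPath A → 𝕜} (hf : AEStronglyMeasurable f μ) :
    ∫⁻ p, ‖increment f p‖ₑ ^ 2 ∂(jumpMeasure J μ) =
      ∫⁻ p, ENNReal.ofReal (jumpWeight J p.1 p.2 * ‖f p.1 - f p.2‖ ^ 2) ∂(μ.prod μ) := by
  rw [lintegral_jumpMeasure ((aestronglyMeasurable_increment hf).enorm.pow_const 2)]
  refine lintegral_congr fun p => ?_
  rw [ENNReal.ofReal_mul' (sq_nonneg _), ENNReal.ofReal_pow (norm_nonneg _), ofReal_norm]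
  rfl

theorem hasFiniteJumpEnergy_iff {f : InfPath A → 𝕜} :
    HasFiniteJumpEnergy J μ f ↔ MemLp f 2 μ ∧ MemLp (increment f) 2 (jumpMeasure J μ) := by
  refine and_congr_right fun hf => ?_
  rw [← lintegral_jumpMeasure_increment hf.1, MemLp,
    and_iff_right ((aestronglyMeasurable_increment hf.1).mono_ac
      (jumpMeasure_absolutelyContinuous J μ)),
    eLpNorm_lt_top_iff_lintegral_rpow_enorm_lt_top two_ne_zero ENNReal.ofNat_ne_top]
  simp

/-- The function `conj(f(x) - f(y)) (g(x) - g(y))`. -/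
def incrementMul (f g : InfPath A → 𝕜) (p : InfPath A × InfPath A) : 𝕜 :=
  starRingEnd 𝕜 (increment f p) * increment g p

theorem incrementMul_eq_inner (f g : InfPath A → 𝕜) (p : InfPath A × InfPath A) :
    incrementMul f g p = inner 𝕜 (increment f p) (increment g p) := by
  rw [RCLike.inner_apply, mul_comm]
  rfl

theorem jumpIntegrand_eq (hJ : ∀ γ, 0 ≤ J γ) (f g : InfPath A → 𝕜)
    (p : InfPath A × InfPath A) :
    jumpIntegrand J f g p =
      (ENNReal.ofReal (jumpWeight J p.1 p.2)).toReal • incrementMul f g p := by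
  rw [ENNReal.toReal_ofReal (jumpWeight_nonneg hJ _ _), RCLike.real_smul_eq_coe_mul]
  rfl

theorem integrable_jumpIntegrand_iff (hJ : ∀ γ, 0 ≤ J γ) (f g : InfPath A → 𝕜) :
    Integrable (jumpIntegrand J f g) (μ.prod μ) ↔
      Integrable (incrementMul f g) (jumpMeasure J μ) := by
  rw [jumpMeasure, integrable_withDensity_iff_integrable_smul'
    (measurable_jumpWeight J).ennreal_ofReal (by simp)]
  simp only [← jumpIntegrand_eq hJ]

theorem jumpForm_eq (hJ : ∀ γ, 0 ≤ J γ) (f g : InfPath A → 𝕜) :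
    jumpForm J μ f g = ∫ p, incrementMul f g p ∂(jumpMeasure J μ) := by
  rw [jumpMeasure, integral_withDensity_eq_integral_toReal_smul
    (measurable_jumpWeight J).ennreal_ofReal (by simp), jumpForm]
  simp only [← jumpIntegrand_eq hJ]

theorem aestronglyMeasurable_incrementMul {f g : InfPath A → 𝕜}
    (hf : AEStronglyMeasurable f μ) (hg : AEStronglyMeasurable g μ) :
    AEStronglyMeasurable (incrementMul f g) (μ.prod μ) := by
  have h := (aestronglyMeasurable_increment hf).inner (𝕜 := 𝕜) (aestronglyMeasurable_increment hg)
  exact h.congr (Eventually.of_forall fun p => (incrementMul_eq_inner f g p).symm)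

/-- Cauchy–Schwarz in `L²` of the jump measure. -/
theorem integrable_incrementMul {f g : InfPath A → 𝕜} (hf : HasFiniteJumpEnergy J μ f)
    (hg : HasFiniteJumpEnergy J μ g) : Integrable (incrementMul f g) (jumpMeasure J μ) :=
  (hasFiniteJumpEnergy_iff.1 hf).2.star.integrable_mul (hasFiniteJumpEnergy_iff.1 hg).2

end JumpMeasure

/-! ### The trace as a function of the choice function -/

section SpectralForm

variable {k : ℕ} [NeZero k] {V : Type u} {A : Fin k → Matrix V V ℕ} {𝕜 : Type*} [RCLike 𝕜]
  [Fintype V] {μ : Measure (InfPath A)} [IsProbabilityMeasure μ] {w : FinPath A → ℝ}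
  (hw : ∀ γ, 0 < w γ)
  (hadm : ∀ (γ : FinPath A) (p : InfPath A × InfPath A), (p.1 ∈ cylinder γ ∧ p.2 ∈ cylinder γ ∧
      weightDist w p.1 p.2 = cylinderDiam w γ) ↔ p ∈ meetSet γ)
  (hpos : ∀ γ, 0 < extSum μ γ) (s : ℝ)

include hw hadm hpos

/-- The denominator of `J_s` is the normalizing constant of `ν_γ`, so it is absorbed into the law of
`φ(γ)` and `w(γ)^{s-2}` is left over. -/
theorem jumpMeasure_eq_sum_map :
    jumpMeasure (fun γ => w γ ^ (s - 2) / extSum μ γ) μ =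
      Measure.sum fun γ => ENNReal.ofReal (w γ ^ (s - 2)) •
        (choiceMeasure w μ).map (fun φ => (φ γ).1) := by
  rw [jumpMeasure_eq_sum]
  congr 1
  funext γ
  rw [map_choiceMeasure hadm hpos, smul_smul,
    div_eq_mul_inv, ENNReal.ofReal_mul (Real.rpow_pos_of_pos (hw γ) _).le,
    ENNReal.ofReal_inv_of_pos (hpos γ)]

omit hw in
theorem map_choiceMeasure_absolutelyContinuous (γ : FinPath A) :
    (choiceMeasure w μ).map (fun φ => (φ γ).1) ≪ μ.prod μ := by
  rw [map_choiceMeasure hadm hpos]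
  exact (Measure.smul_absolutelyContinuous).trans Measure.absolutelyContinuous_restrict

omit hw in
theorem aestronglyMeasurable_blockEnergy {f g : InfPath A → 𝕜} (hf : AEStronglyMeasurable f μ)
    (hg : AEStronglyMeasurable g μ) (γ : FinPath A) :
    AEStronglyMeasurable (fun φ => blockEnergy w s f g γ (φ γ).1) (choiceMeasure w μ) := by
  have h := ((aestronglyMeasurable_incrementMul hf hg).mono_ac
    (map_choiceMeasure_absolutelyContinuous hadm hpos γ)).comp_measurable (measurable_choice γ)
  exact h.const_mul _

theorem lintegral_blockEnergy {f g : InfPath A → 𝕜} (hf : AEStronglyMeasurable f μ)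
    (hg : AEStronglyMeasurable g μ) :
    ∑' γ, ∫⁻ φ, ‖blockEnergy w s f g γ (φ γ).1‖ₑ ∂(choiceMeasure w μ) =
      ∫⁻ p, ‖incrementMul f g p‖ₑ ∂(jumpMeasure (fun γ => w γ ^ (s - 2) / extSum μ γ) μ) := by
  rw [jumpMeasure_eq_sum_map hw hadm hpos, lintegral_sum_measure]
  refine tsum_congr fun γ => ?_
  have hm := (aestronglyMeasurable_incrementMul hf hg).mono_ac
    (map_choiceMeasure_absolutelyContinuous hadm hpos γ)
  rw [lintegral_smul_measure, lintegral_map' hm.enorm (measurable_choice γ).aemeasurable,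
    smul_eq_mul, ← lintegral_const_mul' _ _ ENNReal.ofReal_ne_top]
  refine lintegral_congr fun φ => ?_
  change ‖((w γ ^ (s - 2) : ℝ) : 𝕜) * incrementMul f g (φ γ).1‖ₑ = _
  rw [enorm_mul, ← ofReal_norm (((w γ ^ (s - 2) : ℝ) : 𝕜)), RCLike.norm_ofReal,
    abs_of_pos (Real.rpow_pos_of_pos (hw γ) _)]

theorem integral_blockEnergy {f g : InfPath A → 𝕜} (hf : AEStronglyMeasurable f μ)
    (hg : AEStronglyMeasurable g μ)
    (hi : Integrable (incrementMul f g)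
      (jumpMeasure (fun γ => w γ ^ (s - 2) / extSum μ γ) μ)) :
    ∑' γ, ∫ φ, blockEnergy w s f g γ (φ γ).1 ∂(choiceMeasure w μ) =
      ∫ p, incrementMul f g p ∂(jumpMeasure (fun γ => w γ ^ (s - 2) / extSum μ γ) μ) := by
  rw [jumpMeasure_eq_sum_map hw hadm hpos] at hi ⊢
  rw [← (hasSum_integral_measure hi).tsum_eq]
  refine tsum_congr fun γ => ?_
  have hm := (aestronglyMeasurable_incrementMul hf hg).mono_ac
    (map_choiceMeasure_absolutelyContinuous hadm hpos γ)
  rw [integral_smul_measure, integral_map (measurable_choice γ).aemeasurable hm,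
    ENNReal.toReal_ofReal (Real.rpow_pos_of_pos (hw γ) _).le, ← integral_smul]
  refine integral_congr_ae (Eventually.of_forall fun φ => ?_)
  simp only [RCLike.real_smul_eq_coe_mul]
  rfl

/-- The `L¹(ν)` norms of the block terms add up to the `L¹` norm of the increment product. Their
finiteness gives absolute convergence of the trace almost surely and permits integration term by
term. -/
theorem spectralFormDefined_of_integrable {f g : InfPath A → 𝕜} (hf : AEStronglyMeasurable f μ)
    (hg : AEStronglyMeasurable g μ)
    (hi : Integrable (incrementMul f g)
      (jumpMeasure (fun γ => w γ ^ (s - 2) / extSum μ γ) μ)) :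
    SpectralFormDefined w s μ f g ∧ spectralForm w s μ f g =
      ∫ p, incrementMul f g p ∂(jumpMeasure (fun γ => w γ ^ (s - 2) / extSum μ γ) μ) := by
  have hm := aestronglyMeasurable_blockEnergy hadm hpos s hf hg
  have hfin : ∑' γ, ∫⁻ φ, ‖blockEnergy w s f g γ (φ γ).1‖ₑ ∂(choiceMeasure w μ) ≠ ∞ := by
    rw [lintegral_blockEnergy hw hadm hpos s hf hg]
    exact hi.2.ne
  have hsum : ∀ᵐ φ ∂(choiceMeasure w μ), Summable fun γ => blockEnergy w s f g γ (φ γ).1 := by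
    have h := summable_norm_of_tsum_eLpNorm_ne_top le_rfl hm
      (by simpa only [eLpNorm_one_eq_lintegral_enorm] using hfin)
    filter_upwards [h] with φ hφ using hφ.of_norm
  have hint : Integrable (fun φ => ∑' γ, blockEnergy w s f g γ (φ γ).1) (choiceMeasure w μ) := by
    refine ⟨?_, ?_⟩
    · refine aestronglyMeasurable_of_tendsto_ae (u := (atTop : Filter (Finset (FinPath A))))
        (f := fun t φ => ∑ γ ∈ t, blockEnergy w s f g γ (φ γ).1)
        (fun t => Finset.aestronglyMeasurable_fun_sum _ fun γ _ => hm γ) ?_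
      filter_upwards [hsum] with φ hφ using hφ.hasSum
    · refine lt_of_le_of_lt (lintegral_mono fun φ => enorm_tsum_le_tsum_enorm) ?_
      rw [lintegral_tsum fun γ => (hm γ).enorm]
      exact hfin.lt_top
  refine ⟨⟨?_, ?_⟩, ?_⟩
  · filter_upwards [hsum] with φ hφ using (hasTrace_energyOp_iff hw s φ f g).2 hφ
  · simp only [opTrace_energyOp hw]
    exact hint.const_mul 2
  · rw [spectralForm]
    simp only [opTrace_energyOp hw]
    rw [integral_const_mul, integral_tsum hm hfin,
      integral_blockEnergy hw hadm hpos s hf hg hi, ← mul_assoc]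
    -- The factor 1/2 of the form cancels the two equal diagonal entries per block.
    norm_num

/-- For `f = g` every block term is nonnegative, so there is no cancellation: an integrable trace
bounds the sum of the absolute values, and Tonelli gives the energy. -/
theorem hasFiniteJumpEnergy_of_spectralFormDefined {f : InfPath A → 𝕜} (hf : MemLp f 2 μ)
    (h : SpectralFormDefined w s μ f f) :
    HasFiniteJumpEnergy (fun γ => w γ ^ (s - 2) / extSum μ γ) μ f := by
  refine ⟨hf, ?_⟩
  rw [← lintegral_jumpMeasure_increment hf.1]
  have hsq : ∀ p, ‖increment f p‖ₑ ^ 2 = ‖incrementMul f f p‖ₑ := fun p => by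
    rw [incrementMul, enorm_mul, RCLike.enorm_conj, pow_two]
  simp only [hsq]
  rw [← lintegral_blockEnergy hw hadm hpos s hf.1 hf.1, ← lintegral_tsum fun γ =>
    (aestronglyMeasurable_blockEnergy hadm hpos s hf.1 hf.1 γ).enorm]
  refine lt_of_le_of_lt (lintegral_mono_ae ?_) h.2.2
  filter_upwards [h.1] with φ hφ
  rw [hasTrace_energyOp_iff hw] at hφ
  rw [opTrace_energyOp hw]
  have hb : ∀ γ, blockEnergy w s f f γ (φ γ).1 = ((‖blockEnergy w s f f γ (φ γ).1‖ : ℝ) : 𝕜) := by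
    intro γ
    rw [blockEnergy, RCLike.conj_mul, norm_mul, norm_pow, RCLike.norm_ofReal, RCLike.norm_ofReal,
      abs_of_pos (Real.rpow_pos_of_pos (hw γ) _), abs_norm]
    push_cast
    rfl
  have h1 : ∑' γ, blockEnergy w s f f γ (φ γ).1 =
      ((∑' γ, ‖blockEnergy w s f f γ (φ γ).1‖ : ℝ) : 𝕜) := by
    rw [RCLike.ofReal_tsum]
    exact tsum_congr hb
  rw [h1, two_mul, ← RCLike.ofReal_add, ← ofReal_norm, RCLike.norm_ofReal]
  have h0 : 0 ≤ ∑' γ, ‖blockEnergy w s f f γ (φ γ).1‖ := tsum_nonneg fun _ => norm_nonneg _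
  have h2 : ∑' γ, ‖blockEnergy w s f f γ (φ γ).1‖ₑ =
      ENNReal.ofReal (∑' γ, ‖blockEnergy w s f f γ (φ γ).1‖) := by
    rw [ENNReal.ofReal_tsum_of_nonneg (fun _ => norm_nonneg _) hφ.norm]
    simp only [ofReal_norm]
  rw [h2]
  exact ENNReal.ofReal_le_ofReal (by rw [abs_of_nonneg (by positivity)]; linarith)

end SpectralForm

/-! ### Closures of forms given by a closed graph -/

section GraphClosure

variable {𝕜 H₁ H₂ : Type*} [RCLike 𝕜] [NormedAddCommGroup H₁] [InnerProductSpace 𝕜 H₁]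
  [CompleteSpace H₁] [NormedAddCommGroup H₂] [InnerProductSpace 𝕜 H₂] [CompleteSpace H₂]
  {G : Submodule 𝕜 (WithLp 2 (H₁ × H₂))} {C : Submodule 𝕜 H₁} {q Q : H₁ → H₁ → 𝕜}

/-- Being Cauchy for the form means that the second components are Cauchy in `H₂`. By completeness
the graph vectors converge, and closedness keeps the limit in G. -/
theorem tendsto_graph_of_formApprox (hG : IsClosed (G : Set (WithLp 2 (H₁ × H₂))))
    (hC : ∀ u ∈ C, ∃ z ∈ G, z.fst = u)
    (hq : ∀ z ∈ G, ∀ z' ∈ G, q z.fst z'.fst = inner 𝕜 z.snd z'.snd)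
    {u : ℕ → H₁} {f : H₁} (hu : FormApprox q C u f) :
    ∃ z : ℕ → WithLp 2 (H₁ × H₂), ∃ l ∈ G, (∀ n, z n ∈ G) ∧ (∀ n, (z n).fst = u n) ∧
      l.fst = f ∧ Tendsto z atTop (𝓝 l) := by
  choose z hzG hz using fun n => hC (u n) (hu.mem n)
  have hcau : CauchySeq fun n => (z n).snd := by
    rw [cauchySeq_iff_tendsto_dist_atTop_0]
    have h := hu.cauchy.norm
    have h2 : ∀ p : ℕ × ℕ, ‖q (u p.1 - u p.2) (u p.1 - u p.2)‖ =
        dist (z p.1).snd (z p.2).snd ^ 2 := fun p => by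
      have h3 := hq _ (G.sub_mem (hzG p.1) (hzG p.2)) _ (G.sub_mem (hzG p.1) (hzG p.2))
      rw [WithLp.sub_fst, hz, hz] at h3
      rw [h3, inner_self_eq_norm_sq_to_K, norm_pow, RCLike.norm_ofReal, abs_norm, WithLp.sub_snd,
        dist_eq_norm]
    simp only [h2, norm_zero] at h
    have h4 := h.sqrt
    simpa only [Real.sqrt_sq dist_nonneg, Real.sqrt_zero] using h4
  obtain ⟨b, hb⟩ := cauchySeq_tendsto_of_complete hcau
  have hlim : Tendsto z atTop (𝓝 (WithLp.toLp 2 (f, b))) := by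
    have h1 : Tendsto (fun n => ((z n).fst, (z n).snd)) atTop (𝓝 (f, b)) :=
      (by simpa only [hz] using hu.tendsto : Tendsto (fun n => (z n).fst) atTop (𝓝 f)).prodMk_nhds hb
    exact ((WithLp.prod_continuous_toLp 2 H₁ H₂).tendsto (f, b)).comp h1
  exact ⟨z, _, hG.mem_of_tendsto hlim (Eventually.of_forall hzG), hzG, hz, rfl, hlim⟩

/-- The difference of z and its projection to the closure of K stays in G and is orthogonal to K,
hence is zero. -/
theorem mem_closure_of_orthogonal_eq_zero {E : Type*} [NormedAddCommGroup E]
    [InnerProductSpace 𝕜 E] [CompleteSpace E] {G K : Submodule 𝕜 E} (hG : IsClosed (G : Set E))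
    (hK : K ≤ G) (h0 : ∀ z ∈ G, (∀ c ∈ K, inner 𝕜 c z = 0) → z = 0) {z : E} (hz : z ∈ G) :
    z ∈ closure (K : Set E) := by
  rw [← Submodule.topologicalClosure_coe, SetLike.mem_coe]
  have hle : K.topologicalClosure ≤ G := K.topologicalClosure_minimal hK hG
  have : CompleteSpace K.topologicalClosure :=
    K.isClosed_topologicalClosure.completeSpace_coe
  have h := h0 (z - K.topologicalClosure.starProjection z)
    (G.sub_mem hz (hle (K.topologicalClosure.starProjection_apply_mem z))) fun c hc =>
      K.topologicalClosure.sub_starProjection_mem_orthogonal z c (K.le_topologicalClosure hc)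
  rw [sub_eq_zero.1 h]
  exact K.topologicalClosure.starProjection_apply_mem z

theorem isFormClosure_of_graph (hG : IsClosed (G : Set (WithLp 2 (H₁ × H₂))))
    (hzero : ∀ z ∈ G, z.fst = 0 → z.snd = 0)
    (hdense : ∀ z ∈ G, (∀ c ∈ G, c.fst ∈ C → inner 𝕜 c z = 0) → z = 0)
    (hC : ∀ u ∈ C, ∃ z ∈ G, z.fst = u)
    (hq : ∀ z ∈ G, ∀ z' ∈ G, q z.fst z'.fst = inner 𝕜 z.snd z'.snd)
    (hQ : ∀ z ∈ G, ∀ z' ∈ G, Q z.fst z'.fst = inner 𝕜 z.snd z'.snd) :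
    IsFormClosure q C Q {f | ∃ z ∈ G, z.fst = f} where
  closable u hu := by
    obtain ⟨z, l, hl, hzG, hz, hlf, hlim⟩ := tendsto_graph_of_formApprox hG hC hq hu
    have h : Tendsto (fun n => (z n).snd) atTop (𝓝 l.snd) :=
      ((WithLp.continuous_snd 2 H₁ H₂).tendsto l).comp hlim
    have h2 := h.inner (𝕜 := 𝕜) h
    rw [hzero l hl hlf, inner_zero_left] at h2
    simpa only [← hz, hq _ (hzG _) _ (hzG _)] using h2
  mem_iff f := by
    refine ⟨?_, fun ⟨u, hu⟩ => ?_⟩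
    · rintro ⟨z, hz, rfl⟩
      have hmem : z ∈ closure ((G ⊓ C.comap (WithLp.fstₗ 2 𝕜 H₁ H₂) :
          Submodule 𝕜 (WithLp 2 (H₁ × H₂))) : Set (WithLp 2 (H₁ × H₂))) :=
        mem_closure_of_orthogonal_eq_zero hG inf_le_left
          (fun z hz h => hdense z hz fun c hcG hcC => h c ⟨hcG, hcC⟩) hz
      obtain ⟨c, hcK, hlim⟩ := mem_closure_iff_seq_limit.1 hmem
      refine ⟨fun n => (c n).fst, fun n => (hcK n).2,
        ((WithLp.continuous_fst 2 H₁ H₂).tendsto z).comp hlim, ?_⟩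
      have hs : Tendsto (fun n => (c n).snd) atTop (𝓝 z.snd) :=
        ((WithLp.continuous_snd 2 H₁ H₂).tendsto z).comp hlim
      have hd : Tendsto (fun p : ℕ × ℕ => (c p.1).snd - (c p.2).snd) atTop (𝓝 0) := by
        rw [← prod_atTop_atTop_eq, ← sub_self z.snd]
        exact (hs.comp tendsto_fst).sub (hs.comp tendsto_snd)
      have h2 := hd.inner (𝕜 := 𝕜) hd
      rw [inner_zero_left] at h2
      refine h2.congr fun p => ?_
      have hp := G.sub_mem (hcK p.1).1 (hcK p.2).1
      exact (hq _ hp _ hp).symm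
    · obtain ⟨z, l, hl, -, -, hlf, -⟩ := tendsto_graph_of_formApprox hG hC hq hu
      exact ⟨l, hl, hlf⟩
  form_eq f g u v hu hv := by
    obtain ⟨z, l, hl, hzG, hz, rfl, hlim⟩ := tendsto_graph_of_formApprox hG hC hq hu
    obtain ⟨z', l', hl', hzG', hz', rfl, hlim'⟩ := tendsto_graph_of_formApprox hG hC hq hv
    rw [hQ l hl l' hl']
    have h : Tendsto (fun n => (z n).snd) atTop (𝓝 l.snd) :=
      ((WithLp.continuous_snd 2 H₁ H₂).tendsto l).comp hlim
    have h' : Tendsto (fun n => (z' n).snd) atTop (𝓝 l'.snd) :=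
      ((WithLp.continuous_snd 2 H₁ H₂).tendsto l').comp hlim'
    simpa only [← hz, ← hz', hq _ (hzG _) _ (hzG' _)] using h.inner (𝕜 := 𝕜) h'

end GraphClosure

/-! ### The graph of the increment operator -/

section IncrementGraph

variable {X 𝕜 : Type*} [MeasurableSpace X] [RCLike 𝕜] {μ : Measure X} [SFinite μ]
  {m : Measure (X × X)}

/-- Absolute continuity makes the increment well defined on `L²(μ)` classes. -/
theorem increment_congr_ae (hm : m ≪ μ.prod μ) {f g : X → 𝕜} (h : f =ᵐ[μ] g) :
    increment f =ᵐ[m] increment g := by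
  have h1 : ∀ᵐ p ∂(μ.prod μ), f p.1 = g p.1 := Measure.quasiMeasurePreserving_fst.ae h
  have h2 : ∀ᵐ p ∂(μ.prod μ), f p.2 = g p.2 := Measure.quasiMeasurePreserving_snd.ae h
  filter_upwards [hm.ae_le h1, hm.ae_le h2] with p hp1 hp2
  rw [increment, increment, hp1, hp2]

/-- The graph of the operator that maps `f ∈ L²(μ)` to `f(x) - f(y)`, as an operator into
`L²(m)`. -/
def incrementGraph (𝕜 : Type*) [RCLike 𝕜] (hm : m ≪ μ.prod μ) :
    Submodule 𝕜 (WithLp 2 (Lp 𝕜 2 μ × Lp 𝕜 2 m)) where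
  carrier := {z | z.snd =ᵐ[m] increment z.fst}
  zero_mem' := by
    have h := increment_congr_ae hm (Lp.coeFn_zero 𝕜 2 μ)
    change ((0 : Lp 𝕜 2 m) : X × X → 𝕜) =ᵐ[m] increment ((0 : Lp 𝕜 2 μ) : X → 𝕜)
    filter_upwards [h, Lp.coeFn_zero 𝕜 2 m] with p h1 h2
    rw [h1, h2]
    simp [increment]
  add_mem' := by
    intro a b ha hb
    have h := increment_congr_ae hm (Lp.coeFn_add a.fst b.fst)
    change ((a.snd + b.snd : Lp 𝕜 2 m) : X × X → 𝕜) =ᵐ[m]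
      increment ((a.fst + b.fst : Lp 𝕜 2 μ) : X → 𝕜)
    filter_upwards [h, Lp.coeFn_add a.snd b.snd, ha, hb] with p h1 h2 h3 h4
    rw [h1, h2, Pi.add_apply, h3, h4]
    simp only [increment, Pi.add_apply]
    ring
  smul_mem' := by
    intro c a ha
    have h := increment_congr_ae hm (Lp.coeFn_smul c a.fst)
    change ((c • a.snd : Lp 𝕜 2 m) : X × X → 𝕜) =ᵐ[m]
      increment ((c • a.fst : Lp 𝕜 2 μ) : X → 𝕜)
    filter_upwards [h, Lp.coeFn_smul c a.snd, ha] with p h1 h2 h3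
    rw [h1, h2, Pi.smul_apply, h3]
    simp only [increment, Pi.smul_apply, smul_sub]

theorem mem_incrementGraph {hm : m ≪ μ.prod μ} {z : WithLp 2 (Lp 𝕜 2 μ × Lp 𝕜 2 m)} :
    z ∈ incrementGraph 𝕜 hm ↔ z.snd =ᵐ[m] increment z.fst := Iff.rfl

theorem exists_mem_incrementGraph_iff {hm : m ≪ μ.prod μ} {f : Lp 𝕜 2 μ} :
    (∃ z ∈ incrementGraph 𝕜 hm, z.fst = f) ↔ MemLp (increment f) 2 m := by
  constructor
  · rintro ⟨z, hz, rfl⟩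
    exact (memLp_congr_ae hz).1 (Lp.memLp z.snd)
  · intro h
    exact ⟨WithLp.toLp 2 (f, h.toLp _), h.coeFn_toLp, rfl⟩

theorem exists_subseq_tendsto_ae {Y : Type*} [MeasurableSpace Y] {m : Measure Y}
    {g : ℕ → Lp 𝕜 2 m} {l : Lp 𝕜 2 m} (h : Tendsto g atTop (𝓝 l)) :
    ∃ ns : ℕ → ℕ, StrictMono ns ∧ ∀ᵐ x ∂m, Tendsto (fun n => g (ns n) x) atTop (𝓝 (l x)) :=
  (tendstoInMeasure_of_tendsto_Lp h).exists_seq_tendsto_ae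

theorem isClosed_incrementGraph (hm : m ≪ μ.prod μ) :
    IsClosed (incrementGraph 𝕜 hm : Set (WithLp 2 (Lp 𝕜 2 μ × Lp 𝕜 2 m))) := by
  refine IsSeqClosed.isClosed fun z l hz hl => ?_
  have h1 : Tendsto (fun n => (z n).fst) atTop (𝓝 l.fst) :=
    ((WithLp.continuous_fst 2 _ _).tendsto l).comp hl
  have h2 : Tendsto (fun n => (z n).snd) atTop (𝓝 l.snd) :=
    ((WithLp.continuous_snd 2 _ _).tendsto l).comp hl
  obtain ⟨a, ha, hae⟩ := exists_subseq_tendsto_ae h1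
  -- The second subsequence is taken inside the first, so both almost everywhere limits hold along
  -- the same indices.
  obtain ⟨b, hb, hbe⟩ := exists_subseq_tendsto_ae (h2.comp ha.tendsto_atTop)
  have h3 := hm.ae_le (Measure.quasiMeasurePreserving_fst.ae hae)
  have h4 := hm.ae_le (Measure.quasiMeasurePreserving_snd.ae hae)
  have h5 : ∀ᵐ p ∂m, ∀ n, (z n).snd p = increment (z n).fst p :=
    ae_all_iff.2 fun n => hz n
  refine mem_incrementGraph.2 ?_
  filter_upwards [h3, h4, h5, hbe] with p hp3 hp4 hp5 hp6
  simp only [Function.comp_apply, hp5] at hp6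
  exact tendsto_nhds_unique hp6 ((hp3.sub hp4).comp hb.tendsto_atTop)

end IncrementGraph

/-! ### Step functions -/

section StepFunctions

variable {k : ℕ} [NeZero k] {V : Type u} {A : Fin k → Matrix V V ℕ} {𝕜 : Type*} [RCLike 𝕜]

/-- The finite paths of length `n`. -/
abbrev LevelPath (A : Fin k → Matrix V V ℕ) (n : ℕ) : Type u := Σ q : V, BPath A n q

/-- The initial sub-path of length `n`, as an element of the set of paths of length `n`. -/
def InfPath.level (n : ℕ) (x : InfPath A) : LevelPath A n := ⟨x.vert n, x.takeAux n⟩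

/-- A path of length `n` as a finite path. -/
abbrev LevelPath.toFinPath {n : ℕ} (a : LevelPath A n) : FinPath A := ⟨n, a⟩

theorem mem_cylinder_level {n : ℕ} {x : InfPath A} {a : LevelPath A n} :
    x ∈ cylinder a.toFinPath ↔ x.level n = a := by
  rw [mem_pathCylinder]
  change (⟨n, x.level n⟩ : FinPath A) = ⟨n, a⟩ ↔ _
  simp

theorem take_eq_iff_level {n : ℕ} {x y : InfPath A} :
    x.take n = y.take n ↔ x.level n = y.level n := by
  change (⟨n, x.level n⟩ : FinPath A) = ⟨n, y.level n⟩ ↔ _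
  simp

/-- Paths that differ at level n have already split, so their meet is determined by the initial
segments of length n. -/
theorem jumpWeight_congr_level (J : FinPath A → ℝ) {n : ℕ} {x y x' y' : InfPath A}
    (hx : x.level n = x'.level n) (hy : y.level n = y'.level n) (hne : x.level n ≠ y.level n) :
    jumpWeight J x y = jumpWeight J x' y' := by
  rw [← take_eq_iff_level] at hx hy
  have hne : x.take n ≠ y.take n := fun h => hne (take_eq_iff_level.1 h)
  by_cases h0 : x.take 0 = y.take 0
  · obtain ⟨j, hj, hj'⟩ := exists_take_split (fun h => hne (by rw [h])) h0
    have hjn : j + 1 ≤ n := by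
      by_contra hlt
      exact hne (InfPath.take_eq_of_le (by omega) hj)
    have e1 := InfPath.take_eq_of_le hjn hx
    have e2 := InfPath.take_eq_of_le hjn hy
    have h1 := mem_meetSet_of_split hj hj'
    have h2 := mem_meetSet_of_split (x := x') (y := y') (n := j)
      (by rw [← InfPath.take_eq_of_succ e1, ← InfPath.take_eq_of_succ e2, hj])
      (by rwa [← e1, ← e2])
    rw [jumpWeight_of_mem J h1, jumpWeight_of_mem J h2, InfPath.take_eq_of_succ e1]
  · have h0' : x'.take 0 ≠ y'.take 0 := by
      rwa [← InfPath.take_eq_of_le (Nat.zero_le n) hx, ← InfPath.take_eq_of_le (Nat.zero_le n) hy]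
    rw [jumpWeight, jumpWeight, meet_eq_none h0, meet_eq_none h0']
    simp

variable [Finite V]

theorem iUnion_cylinder_level (n : ℕ) :
    ⋃ a : LevelPath A n, cylinder a.toFinPath = Set.univ :=
  Set.eq_univ_of_forall fun x => Set.mem_iUnion.2 ⟨x.level n, mem_cylinder_level.2 rfl⟩

theorem pairwise_disjoint_cylinder_level (n : ℕ) :
    Pairwise (Function.onFun Disjoint fun a : LevelPath A n => cylinder a.toFinPath) :=
  fun _ _ hab => cylinder_disjoint_of_len (fun h => hab (by simpa using h)) rfl

variable {μ : Measure (InfPath A)} [IsProbabilityMeasure μ] {J : FinPath A → ℝ}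

/-- The element of `L²` that takes the value `c a` on the cylinder set `[a]`, for all paths `a` of
length `n`. -/
noncomputable def stepLp (μ : Measure (InfPath A)) [IsProbabilityMeasure μ] {n : ℕ}
    (c : LevelPath A n → 𝕜) : Lp 𝕜 2 μ :=
  have := Fintype.ofFinite (LevelPath A n)
  ∑ a, c a • indicatorConstLp 2 (measurableSet_cylinder a.toFinPath) (measure_ne_top μ _) (1 : 𝕜)

theorem stepLp_mem (n : ℕ) (c : LevelPath A n → 𝕜) : stepLp μ c ∈ cylinderSpan 𝕜 μ :=
  Submodule.sum_mem _ fun a _ => Submodule.smul_mem _ _ (Submodule.subset_span ⟨a.toFinPath, rfl⟩)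

theorem coeFn_stepLp {n : ℕ} (c : LevelPath A n → 𝕜) :
    stepLp μ c =ᵐ[μ] fun x => c (x.level n) := by
  classical
  let := Fintype.ofFinite (LevelPath A n)
  have h1 : ∀ a : LevelPath A n, ∀ᵐ x ∂μ, (c a • indicatorConstLp 2
      (measurableSet_cylinder a.toFinPath) (measure_ne_top μ _) (1 : 𝕜) : Lp 𝕜 2 μ) x =
        if x.level n = a then c a else 0 := fun a => by
    filter_upwards [Lp.coeFn_smul (c a) (indicatorConstLp 2
      (measurableSet_cylinder a.toFinPath) (measure_ne_top μ _) (1 : 𝕜)),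
      indicatorConstLp_coeFn (p := 2) (hs := measurableSet_cylinder a.toFinPath)
        (hμs := measure_ne_top μ _) (c := (1 : 𝕜))] with x hx hx'
    rw [hx, Pi.smul_apply, hx', Set.indicator_apply, mem_cylinder_level]
    simp
  have h2 := Lp.coeFn_finsetSum (p := 2) (μ := μ) Finset.univ fun a : LevelPath A n =>
    c a • indicatorConstLp 2 (measurableSet_cylinder a.toFinPath) (measure_ne_top μ _) (1 : 𝕜)
  filter_upwards [ae_all_iff.2 h1, h2] with x hx hx'
  refine (show stepLp μ c x = _ from hx').trans ?_
  simp [Finset.sum_apply, hx]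

theorem inner_stepLp {n : ℕ} (c : LevelPath A n → 𝕜) (f : Lp 𝕜 2 μ)
    (hf : ∀ a : LevelPath A n, ∫ x in cylinder a.toFinPath, f x ∂μ = 0) :
    inner 𝕜 (stepLp μ c) f = 0 := by
  rw [stepLp, sum_inner]
  refine Finset.sum_eq_zero fun a _ => ?_
  rw [inner_smul_left, L2.inner_indicatorConstLp_one, hf, mul_zero]

theorem memLp_level {n : ℕ} (c : LevelPath A n → 𝕜) :
    MemLp (fun x : InfPath A => c (x.level n)) 2 μ :=
  (memLp_congr_ae (coeFn_stepLp c)).1 (Lp.memLp _)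

theorem hasFiniteJumpEnergy_level {n : ℕ} (c : LevelPath A n → 𝕜) :
    HasFiniteJumpEnergy J μ fun x : InfPath A => c (x.level n) := by
  refine ⟨memLp_level c, ?_⟩
  have hfac : Function.FactorsThrough
      (fun p : InfPath A × InfPath A =>
        jumpWeight J p.1 p.2 * ‖c (p.1.level n) - c (p.2.level n)‖ ^ 2)
      (fun p : InfPath A × InfPath A => (p.1.level n, p.2.level n)) := by
    rintro ⟨x, y⟩ ⟨x', y'⟩ h
    simp only [Prod.mk.injEq] at h
    by_cases hne : x.level n = y.level n
    -- On equal levels the weight may vary, even without bound, but the increment of the step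
    -- function is 0.
    · simp [← h.1, ← h.2, hne]
    · simp only
      rw [jumpWeight_congr_level J h.1 h.2 hne, h.1, h.2]
  obtain ⟨e, he⟩ := (Function.factorsThrough_iff _).1 hfac
  obtain ⟨C, hC⟩ := (Set.finite_range e).bddAbove
  refine lt_of_le_of_lt (lintegral_mono (g := fun _ => ENNReal.ofReal C) fun p => ?_) ?_
  · exact ENNReal.ofReal_le_ofReal ((congrFun he p).le.trans (hC ⟨_, rfl⟩))
  · rw [lintegral_const, measure_univ, mul_one]
    exact ENNReal.ofReal_lt_top

theorem HasFiniteJumpEnergy.congr {f g : InfPath A → 𝕜} (hf : HasFiniteJumpEnergy J μ f)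
    (h : f =ᵐ[μ] g) : HasFiniteJumpEnergy J μ g := by
  rw [hasFiniteJumpEnergy_iff] at hf ⊢
  exact ⟨(memLp_congr_ae h).1 hf.1, (memLp_congr_ae
    (increment_congr_ae (jumpMeasure_absolutelyContinuous J μ) h)).1 hf.2⟩

theorem hasFiniteJumpEnergy_stepLp {n : ℕ} (c : LevelPath A n → 𝕜) :
    HasFiniteJumpEnergy J μ (stepLp μ c) :=
  (hasFiniteJumpEnergy_level c).congr (coeFn_stepLp c).symm

theorem setIntegral_rectangle {n : ℕ} {f : InfPath A → 𝕜} (hf : Integrable f μ)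
    (hf0 : ∀ a : LevelPath A n, ∫ x in cylinder a.toFinPath, f x ∂μ = 0) (a b : LevelPath A n) :
    ∫ p in cylinder a.toFinPath ×ˢ cylinder b.toFinPath, increment f p ∂(μ.prod μ) = 0 := by
  have h1 := setIntegral_prod_mul (μ := μ) (ν := μ) f (fun _ => (1 : 𝕜)) (cylinder a.toFinPath)
    (cylinder b.toFinPath)
  have h2 := setIntegral_prod_mul (μ := μ) (ν := μ) (fun _ => (1 : 𝕜)) f (cylinder a.toFinPath)
    (cylinder b.toFinPath)
  rw [hf0, zero_mul] at h1
  rw [hf0, mul_zero] at h2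
  simp only [mul_one] at h1
  simp only [one_mul] at h2
  simp only [increment]
  rw [integral_sub (hf.comp_fst μ).integrableOn (hf.comp_snd μ).integrableOn, h1, h2, sub_zero]

/-- On a rectangle of two different level-n cylinders the weight and the step increment are
constant, and the increment of f has mean zero there. On diagonal rectangles the step increment
vanishes. -/
theorem integral_incrementMul_level (hJ : ∀ γ, 0 ≤ J γ) {n : ℕ} (c : LevelPath A n → 𝕜)
    {f : InfPath A → 𝕜} (hf : HasFiniteJumpEnergy J μ f)
    (hc : HasFiniteJumpEnergy J μ fun x : InfPath A => c (x.level n))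
    (hf0 : ∀ a : LevelPath A n, ∫ x in cylinder a.toFinPath, f x ∂μ = 0) :
    ∫ p, incrementMul (fun x : InfPath A => c (x.level n)) f p ∂(jumpMeasure J μ) = 0 := by
  have := Fintype.ofFinite (LevelPath A n)
  have hint := (integrable_jumpIntegrand_iff hJ _ _).2 (integrable_incrementMul hc hf)
  rw [← jumpForm_eq hJ, jumpForm, ← setIntegral_univ]
  have hU : (Set.univ : Set (InfPath A × InfPath A)) = ⋃ t : LevelPath A n × LevelPath A n,
      cylinder t.1.toFinPath ×ˢ cylinder t.2.toFinPath := by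
    refine (Set.eq_univ_of_forall fun p => Set.mem_iUnion.2 ⟨(p.1.level n, p.2.level n), ?_⟩).symm
    exact ⟨mem_cylinder_level.2 rfl, mem_cylinder_level.2 rfl⟩
  rw [hU, integral_iUnion_fintype]
  · refine Finset.sum_eq_zero fun t _ => ?_
    rcases Set.eq_empty_or_nonempty
      (cylinder t.1.toFinPath ×ˢ cylinder t.2.toFinPath) with he | ⟨⟨x, y⟩, hx, hy⟩
    · rw [he, setIntegral_empty]
    rw [mem_cylinder_level] at hx hy
    have hcongr : ∀ p ∈ cylinder t.1.toFinPath ×ˢ cylinder t.2.toFinPath,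
        jumpIntegrand J (fun x : InfPath A => c (x.level n)) f p =
          ((jumpWeight J x y : 𝕜) * starRingEnd 𝕜 (c t.1 - c t.2)) * increment f p := by
      rintro ⟨x', y'⟩ ⟨hx', hy'⟩
      rw [mem_cylinder_level] at hx' hy'
      simp only at hx hy hx' hy'
      rw [jumpIntegrand, increment]
      simp only [hx', hy']
      by_cases hne : t.1 = t.2
      · simp [hne]
      · rw [jumpWeight_congr_level J (hx'.trans hx.symm) (hy'.trans hy.symm) (by rwa [hx', hy']),
          mul_assoc]
    rw [setIntegral_congr_fun ((measurableSet_cylinder _).prod (measurableSet_cylinder _)) hcongr,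
      integral_const_mul, setIntegral_rectangle (hf.1.integrable (by norm_num)) hf0, mul_zero]
  · exact fun t => (measurableSet_cylinder _).prod (measurableSet_cylinder _)
  · intro t t' hne
    rw [Function.onFun, Set.disjoint_left]
    rintro ⟨x, y⟩ ⟨h1, h2⟩ ⟨h3, h4⟩
    rw [mem_cylinder_level] at h1 h2 h3 h4
    exact hne (Prod.ext (h1.symm.trans h3) (h2.symm.trans h4))
  · exact fun t => hint.integrableOn

theorem eq_zero_of_setIntegral_cylinder {f : Lp 𝕜 2 μ}
    (h : ∀ γ : FinPath A, ∫ x in cylinder γ, f x ∂μ = 0) : f = 0 := by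
  have hint : Integrable f μ := (Lp.memLp f).integrable (by norm_num)
  -- Needed for complements in the π-λ argument; the level-0 cylinders partition the space.
  have huniv : ∫ x, f x ∂μ = 0 := by
    have := Fintype.ofFinite (LevelPath A 0)
    rw [← setIntegral_univ, ← iUnion_cylinder_level 0,
      integral_iUnion_fintype (fun a => measurableSet_cylinder _)
        (pairwise_disjoint_cylinder_level 0) fun a => hint.integrableOn]
    exact Finset.sum_eq_zero fun a _ => h _
  have hall : ∀ s : Set (InfPath A), MeasurableSet s → ∫ x in s, f x ∂μ = 0 := by
    refine MeasurableSpace.induction_on_inter (C := fun s _ => ∫ x in s, f x ∂μ = 0)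
      borel_eq_generateFrom_cylinder isPiSystem_cylinder (by simp) ?_ ?_ ?_
    · rintro _ ⟨γ, rfl⟩
      exact h γ
    · intro t ht ih
      rw [setIntegral_compl ht hint, ih, huniv, sub_zero]
    · intro t hd hm ih
      rw [integral_iUnion hm hd hint.integrableOn]
      simp [ih]
  rw [Lp.eq_zero_iff_ae_eq_zero]
  exact hint.ae_eq_zero_of_forall_setIntegral_eq_zero fun s hs _ => hall s hs

theorem inner_snd_incrementGraph {z z' : WithLp 2 (Lp 𝕜 2 μ × Lp 𝕜 2 (jumpMeasure J μ))}
    (hz : z ∈ incrementGraph 𝕜 (jumpMeasure_absolutelyContinuous J μ))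
    (hz' : z' ∈ incrementGraph 𝕜 (jumpMeasure_absolutelyContinuous J μ)) :
    inner 𝕜 z.snd z'.snd = ∫ p, incrementMul z.fst z'.fst p ∂(jumpMeasure J μ) := by
  rw [L2.inner_def]
  refine integral_congr_ae ?_
  filter_upwards [hz, hz'] with p h h'
  rw [h, h', incrementMul_eq_inner]

theorem exists_mem_incrementGraph {f : Lp 𝕜 2 μ} :
    (∃ z ∈ incrementGraph 𝕜 (jumpMeasure_absolutelyContinuous J μ), z.fst = f) ↔
      HasFiniteJumpEnergy J μ f := by
  rw [exists_mem_incrementGraph_iff, hasFiniteJumpEnergy_iff, and_iff_right (Lp.memLp f)]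

/-- Let w be the graph vector over the level-n average of z. Then `z - w` has mean zero on level-n
cylinders and is orthogonal to w in both components. As z is orthogonal to w too, w is zero, and z
itself has mean zero on these cylinders. -/
theorem eq_zero_of_orthogonal_cylinderSpan (hJ : ∀ γ, 0 ≤ J γ)
    (hμ : ∀ γ : FinPath A, 0 < μ (cylinder γ))
    {z : WithLp 2 (Lp 𝕜 2 μ × Lp 𝕜 2 (jumpMeasure J μ))}
    (hz : z ∈ incrementGraph 𝕜 (jumpMeasure_absolutelyContinuous J μ))
    (h : ∀ c ∈ incrementGraph 𝕜 (jumpMeasure_absolutelyContinuous J μ),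
      c.fst ∈ cylinderSpan 𝕜 μ → inner 𝕜 c z = 0) : z.fst = 0 := by
  have hi : ∀ f : Lp 𝕜 2 μ, Integrable f μ := fun f => (Lp.memLp f).integrable (by norm_num)
  refine eq_zero_of_setIntegral_cylinder fun γ => ?_
  obtain ⟨n, b⟩ := γ
  -- The conditional expectation on the cylinders of level n; the denominators are nonzero because
  -- cylinders have positive measure.
  set c : LevelPath A n → 𝕜 := fun a =>
    (∫ x in cylinder a.toFinPath, z.fst x ∂μ) / (μ.real (cylinder a.toFinPath) : 𝕜) with hc
  obtain ⟨w, hw, hwc⟩ := exists_mem_incrementGraph.2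
    (hasFiniteJumpEnergy_stepLp (J := J) (μ := μ) c)
  have h0 : ∀ a : LevelPath A n, ∫ x in cylinder a.toFinPath, (z - w).fst x ∂μ = 0 := by
    intro a
    have hne : (μ.real (cylinder a.toFinPath) : 𝕜) ≠ 0 := by
      rw [RCLike.ofReal_ne_zero]
      exact (ENNReal.toReal_pos (hμ _).ne' (measure_ne_top _ _)).ne'
    have h1 : ∫ x in cylinder a.toFinPath, w.fst x ∂μ =
        ∫ x in cylinder a.toFinPath, c a ∂μ := by
      refine setIntegral_congr_ae (measurableSet_cylinder _) ?_
      rw [hwc]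
      filter_upwards [coeFn_stepLp (μ := μ) c] with x hx hxa
      rw [hx, mem_cylinder_level.1 hxa]
    rw [WithLp.sub_fst, setIntegral_congr_ae (g := fun x => z.fst x - w.fst x)
      (measurableSet_cylinder _) ((Lp.coeFn_sub z.fst w.fst).mono fun x hx _ => hx),
      integral_sub (hi _).integrableOn (hi _).integrableOn, h1, setIntegral_const,
      RCLike.real_smul_eq_coe_mul, hc]
    simp only
    rw [mul_div_cancel₀ _ hne, sub_self]
  have hzw := Submodule.sub_mem _ hz hw
  have hort : inner 𝕜 w (z - w) = 0 := by
    rw [WithLp.prod_inner_apply]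
    change inner 𝕜 w.fst (z - w).fst + inner 𝕜 w.snd (z - w).snd = 0
    rw [inner_snd_incrementGraph hw hzw]
    rw [hwc, inner_stepLp c _ h0, zero_add,
      ← integral_incrementMul_level hJ c (exists_mem_incrementGraph.1 ⟨_, hzw, rfl⟩)
        (hasFiniteJumpEnergy_level c) h0]
    refine integral_congr_ae ?_
    filter_upwards [increment_congr_ae (jumpMeasure_absolutelyContinuous J μ)
      (coeFn_stepLp (μ := μ) c)] with p hp
    rw [incrementMul, hp, incrementMul]
  rw [inner_sub_right, h w hw (by rw [hwc]; exact stepLp_mem n c), zero_sub, neg_eq_zero,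
    inner_self_eq_zero] at hort
  have h2 := h0 b
  rwa [hort, sub_zero] at h2

theorem snd_eq_zero_of_mem_incrementGraph
    {z : WithLp 2 (Lp 𝕜 2 μ × Lp 𝕜 2 (jumpMeasure J μ))}
    (hz : z ∈ incrementGraph 𝕜 (jumpMeasure_absolutelyContinuous J μ)) (h : z.fst = 0) :
    z.snd = 0 := by
  rw [Lp.eq_zero_iff_ae_eq_zero]
  have h1 := increment_congr_ae (jumpMeasure_absolutelyContinuous J μ) (Lp.coeFn_zero 𝕜 2 μ)
  rw [mem_incrementGraph, h] at hz
  filter_upwards [h1, hz] with p h2 h3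
  rw [h3, h2]
  simp [increment]

theorem hasFiniteJumpEnergy_of_mem_cylinderSpan {u : Lp 𝕜 2 μ} (hu : u ∈ cylinderSpan 𝕜 μ) :
    HasFiniteJumpEnergy J μ u := by
  rw [← exists_mem_incrementGraph]
  have hle : cylinderSpan 𝕜 μ ≤ (incrementGraph 𝕜 (jumpMeasure_absolutelyContinuous J μ)).map
      (WithLp.fstₗ 2 𝕜 (Lp 𝕜 2 μ) (Lp 𝕜 2 (jumpMeasure J μ))) := by
    refine Submodule.span_le.2 ?_
    rintro _ ⟨⟨n, b⟩, rfl⟩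
    classical
    have hb : indicatorConstLp 2 (measurableSet_cylinder (⟨n, b⟩ : FinPath A))
        (measure_ne_top μ _) (1 : 𝕜) =ᵐ[μ]
          fun x => (fun a : LevelPath A n => if a = b then (1 : 𝕜) else 0) (x.level n) := by
      refine indicatorConstLp_coeFn.trans (Eventually.of_forall fun x => ?_)
      simp only [Set.indicator_apply]
      exact if_congr (mem_cylinder_level (a := b)) rfl rfl
    exact exists_mem_incrementGraph.2 ((hasFiniteJumpEnergy_level
      fun a : LevelPath A n => if a = b then (1 : 𝕜) else 0).congr hb.symm)
  exact hle hu

end StepFunctions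

/-! ### Identification of the spectral form with the jump form -/

theorem mainTheorem2 {k : ℕ} [NeZero k] {Λ : Type u} [Category.{v} Λ] [Fintype Λ] [DecidableEq Λ]
    (G : HigherRankGraph k Λ) (hfin : G.IsFinite) (hconn : G.IsStronglyConnected)
    (hrho : ∀ i, 1 < rho G.vertexMatrix i)
    (κ : Λ → ℝ) (hκ : IsPerronFrobeniusVector G.vertexMatrix κ)
    (δ : ℝ) (hδ0 : 0 < δ) (hδ1 : δ < 1)
    (hdiam : ∀ γ : FinPath G.vertexMatrix,
      cylinderDiam (wt G.vertexMatrix κ δ) γ = wt G.vertexMatrix κ δ γ)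
    (μ : Measure (InfPath G.vertexMatrix)) [IsProbabilityMeasure μ]
    (hμ : IsPerronFrobeniusMeasure G.vertexMatrix κ μ)
    (s : ℝ) (𝕜 : Type*) [RCLike 𝕜] :
    (∀ f : InfPath G.vertexMatrix → 𝕜, MemLp f 2 μ →
      (HasFiniteJumpEnergy (jumpKernel κ δ s μ) μ f ↔
        SpectralFormDefined (wt G.vertexMatrix κ δ) s μ f f)) ∧
    (∀ f g : InfPath G.vertexMatrix → 𝕜,
      HasFiniteJumpEnergy (jumpKernel κ δ s μ) μ f →
      HasFiniteJumpEnergy (jumpKernel κ δ s μ) μ g →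
      SpectralFormDefined (wt G.vertexMatrix κ δ) s μ f g ∧
      Integrable (jumpIntegrand (jumpKernel κ δ s μ) f g) (μ.prod μ) ∧
      spectralForm (wt G.vertexMatrix κ δ) s μ f g = jumpForm (jumpKernel κ δ s μ) μ f g) ∧
    IsFormClosure
      (fun f g : Lp 𝕜 2 μ => spectralForm (wt G.vertexMatrix κ δ) s μ f g) (cylinderSpan 𝕜 μ)
      (fun f g : Lp 𝕜 2 μ => jumpForm (jumpKernel κ δ s μ) μ f g)
      (jumpDomain 𝕜 (jumpKernel κ δ s μ) μ) := by
  have hw : ∀ γ, 0 < wt G.vertexMatrix κ δ γ := wt_pos hrho hκ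
  have hadm := admissible_iff hrho hκ hδ0 hδ1 hdiam
  have hcyl := hμ.cylinder_pos hrho hκ
  have hpos : ∀ γ, 0 < extSum μ γ := fun γ => extSum_pos hcyl
    (meetSet_nonempty hrho hκ hδ0 hδ1 hdiam (nonempty_of_measure_ne_zero (hcyl γ).ne'))
  have hJ : ∀ γ, 0 ≤ jumpKernel κ δ s μ γ := fun γ =>
    div_nonneg (Real.rpow_pos_of_pos (hw γ) _).le (hpos γ).le
  have hform : ∀ f g : InfPath G.vertexMatrix → 𝕜,
      HasFiniteJumpEnergy (jumpKernel κ δ s μ) μ f →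
      HasFiniteJumpEnergy (jumpKernel κ δ s μ) μ g →
      SpectralFormDefined (wt G.vertexMatrix κ δ) s μ f g ∧
      Integrable (jumpIntegrand (jumpKernel κ δ s μ) f g) (μ.prod μ) ∧
      spectralForm (wt G.vertexMatrix κ δ) s μ f g = jumpForm (jumpKernel κ δ s μ) μ f g := by
    intro f g hf hg
    have hi := integrable_incrementMul hf hg
    obtain ⟨h1, h2⟩ := spectralFormDefined_of_integrable hw hadm hpos s hf.1.1 hg.1.1 hi
    exact ⟨h1, (integrable_jumpIntegrand_iff hJ f g).2 hi, h2.trans (jumpForm_eq hJ f g).symm⟩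
  refine ⟨fun f hf => ⟨fun h => (hform f f h h).1,
    hasFiniteJumpEnergy_of_spectralFormDefined hw hadm hpos s hf⟩, hform, ?_⟩
  have hdom : jumpDomain 𝕜 (jumpKernel κ δ s μ) μ =
      {f | ∃ z ∈ incrementGraph 𝕜 (jumpMeasure_absolutelyContinuous (jumpKernel κ δ s μ) μ),
        z.fst = f} :=
    Set.ext fun f => exists_mem_incrementGraph.symm
  have hQ : ∀ z ∈ incrementGraph 𝕜 (jumpMeasure_absolutelyContinuous (jumpKernel κ δ s μ) μ),
      ∀ z' ∈ incrementGraph 𝕜 (jumpMeasure_absolutelyContinuous (jumpKernel κ δ s μ) μ),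
      jumpForm (jumpKernel κ δ s μ) μ z.fst z'.fst = inner 𝕜 z.snd z'.snd :=
    fun z hz z' hz' => (jumpForm_eq hJ _ _).trans (inner_snd_incrementGraph hz hz').symm
  rw [hdom]
  refine isFormClosure_of_graph (isClosed_incrementGraph _)
    (fun z hz h => snd_eq_zero_of_mem_incrementGraph hz h) (fun z hz h => ?_)
    (fun u hu => exists_mem_incrementGraph.2 (hasFiniteJumpEnergy_of_mem_cylinderSpan hu))
    (fun z hz z' hz' => ?_) hQ
  · have h1 := eq_zero_of_orthogonal_cylinderSpan hJ hcyl hz h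
    have h2 := snd_eq_zero_of_mem_incrementGraph hz h1
    exact WithLp.ofLp_injective 2 (Prod.ext h1 h2)
  · exact (hform _ _ (exists_mem_incrementGraph.1 ⟨z, hz, rfl⟩)
      (exists_mem_incrementGraph.1 ⟨z', hz', rfl⟩)).2.2.trans (hQ z hz z' hz')
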